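/- **Setting.** Graphs are finite, simple, connected and non-empty. The $n$ vertices of a graph $G$ carry distinct identifiers in $[1,n^c]$, where $c$ is a fixed constant. A *$t$-model* of $G$ is a rooted tree $\mathcal T$ on $V(G)$ of depth at most $t$ (the root has depth $0$) such that for every edge of $G$ one endpoint is an ancestor of the other; a vertex counts as its own ancestor. The model is *coherent* if for every child $w$ of every vertex $v$ some vertex of the subtree rooted at $w$ is adjacent in $G$ to $v$. (A graph with a $t$-model has treedepth at most $t$.) The *ancestor vector* of a vertex $v$ of depth $i$ is the vector in $\{0,1\}^i$ whose $j$-th coordinate ($0\le j<i$) is $1$ iff $v$ is adjacent in $G$ to its ancestor of depth $j$. The *type* of $v$ in the current (pruned) tree is the isomorphism class of the remaining subtree rooted at $v$, each node labelled by its ancestor vector. If more than $k$ remaining children of a vertex have the same type, a *valid pruning* removes the subtree rooted at one of these children. A *$k$-reduction* $H$ of $G$ from $\mathcal T$ is an induced subgraph of $G$ obtained by iterating valid prunings, each time at the largest possible depth, until none is possible. A vertex is *pruned* if it is the root of a subtree removed in this sequence. The *end type* of a vertex is the last type it has had: its type in $H$ if it belongs to $H$, and otherwise its type just before it was deleted.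 An *instance* is $(G,\mathrm{id},\mathcal T,H)$, where each vertex knows its identifier, the identifier of its parent in $\mathcal T$ (or that it has none), and whether it belongs to $H$. Each vertex also gets a *certificate* (a bit string), and it accepts or rejects as a function of its own identifier, input and certificate and of those of its neighbours in $G$. **Lemma.** There is a function $g(k,t)$ and, for every $c$, a constant $C$ such that for all natural numbers $k,t$ there is such a local verifier with the following properties for all $G$, $\mathrm{id}$, $\mathcal T$ (any assignment of parents to the vertices) and $H\subseteq V(G)$. 1. If $\mathcal T$ is a coherent $t$-model of $G$ and $H$ is a $k$-reduction of $G$ from $\mathcal T$, then there are certificates of at most $C\,(t\log n+g(k,t))$ bits with which all vertices accept. 2. If $\mathcal T$ is not a coherent $t$-model of $G$ or $H$ is not a $k$-reduction of $G$ from $\mathcal T$, then for every assignment of certificates at least one vertex rejects. 3. The certificates record the treedepth data, the pruning bits and the end types: a fixed decoding function (depending only on $c,k,t$) reads off from the certificate of each vertex $v$, for every ancestor of $v$ from $v$ to the root, its identifier, a bit telling whether it is pruned, and a label of its end type, where two vertices of $G$ have the same label iff they have the same end type. The certificates in (1) can be chosen to record these data for any prescribed pruning sequence leading to $H$; and whenever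 all vertices accept, the certificates record these data correctly for some pruning sequence leading to $H$. -/

import Mathlib

namespace KernelCert

/-! ### Rooted trees given by a parent map -/

/-- The vertex reached from `v` by going up `n` times (`none` above the root). -/
def up {V : Type*} (p : V → Option V) (v : V) : ℕ → Option V
  | 0 => some v
  | n + 1 => (up p v n).bind p

/-- `a` is on the path from `v` to the root; every vertex is an ancestor of itself. -/
def IsAncestor {V : Type*} (p : V → Option V) (a v : V) : Prop :=
  ∃ n, up p v n = some a

/-- The number of edges between `v` and the root. -/
noncomputable def depth {V : Type*} (p : V → Option V) (v : V) : ℕ :=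
  sInf {n | up p v (n + 1) = none}

/-- The ancestors of `v`, listed from `v` itself to the root. -/
noncomputable def ancestorList {V : Type*} (p : V → Option V) (v : V) : List V :=
  (List.range (depth p v + 1)).filterMap (up p v)

/-! ### Models (elimination trees) -/

/-- The parent map `p` describes a rooted tree of depth at most `t` on the vertices of `G` such
that the endpoints of each edge of `G` are in ancestor-descendant relation. -/
structure IsModel {V : Type*} (G : SimpleGraph V) (p : V → Option V) (t : ℕ) : Prop where
  existsUnique_root : ∃! r, p r = none
  depth_le : ∀ v, ∃ d ≤ t, up p v (d + 1) = none
  adj : ∀ u v, G.Adj u v → IsAncestor p u v ∨ IsAncestor p v u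

/-- For every child `w` of `v`, some vertex of the subtree rooted at `w` is adjacent to `v`. -/
def IsCoherent {V : Type*} (G : SimpleGraph V) (p : V → Option V) : Prop :=
  ∀ v w, p w = some v → ∃ x, IsAncestor p w x ∧ G.Adj x v

/-! ### Types of vertices -/

/-- The `j`-th coordinate of the ancestor vector of `v` (relevant for `j < depth p v`):
is `v` adjacent to its ancestor at depth `j`? -/
def ancestorVector {V : Type*} (G : SimpleGraph V) (p : V → Option V) (v : V) (j : ℕ) : Prop :=
  ∃ a, IsAncestor p a v ∧ depth p a = j ∧ G.Adj v a

/-- The ancestor vectors of `v` and `w` have the same size and the same coordinates. -/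
def SameAncestorVector {V : Type*} (G : SimpleGraph V) (p : V → Option V) (v w : V) : Prop :=
  depth p v = depth p w ∧ ∀ j < depth p v, (ancestorVector G p v j ↔ ancestorVector G p w j)

/-- The type of `u` when the remaining vertices are those of `S` equals the type of `u'` when the
remaining vertices are those of `S'`: the subtrees rooted at `u` and `u'`, with every node
labelled by its ancestor vector, are isomorphic as rooted labelled trees. -/
def SameType {V : Type*} (G : SimpleGraph V) (p : V → Option V)
    (S : Set V) (u : V) (S' : Set V) (u' : V) : Prop :=
  ∃ e : {x // x ∈ S ∧ IsAncestor p u x} ≃ {x // x ∈ S' ∧ IsAncestor p u' x},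
    (∀ x, x.1 = u ↔ (e x).1 = u') ∧
    (∀ x y, p x.1 = some y.1 ↔ p (e x).1 = some (e y).1) ∧
    ∀ x, SameAncestorVector G p x.1 (e x).1

/-! ### Pruning -/

/-- What remains after the subtrees rooted at the vertices of `ws` have been removed. -/
def remaining {V : Type*} (p : V → Option V) (ws : List V) : Set V :=
  {x | ∀ w ∈ ws, ¬ IsAncestor p w x}

/-- Removing the subtree rooted at `w` is a valid pruning when the remaining vertices are those
of `S`: the parent of `w` has more than `k` children with the type of `w` (`w` included). -/
def CanPrune {V : Type*} (G : SimpleGraph V) (p : V → Option V) (k : ℕ)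
    (S : Set V) (w : V) : Prop :=
  w ∈ S ∧ ∃ u, p w = some u ∧ k < Set.ncard {x | x ∈ S ∧ p x = some u ∧ SameType G p S w S x}

/-- `ws` lists the roots of the subtrees removed by successive valid prunings of `G`, each of them
made at the largest possible depth. -/
inductive IsPruningSequence {V : Type*} (G : SimpleGraph V) (p : V → Option V) (k : ℕ) :
    List V → Prop
  | nil : IsPruningSequence G p k []
  | snoc (ws : List V) (w : V) : IsPruningSequence G p k ws →
      CanPrune G p k (remaining p ws) w →
      (∀ w', CanPrune G p k (remaining p ws) w' → depth p w' ≤ depth p w) →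
      IsPruningSequence G p k (ws ++ [w])

/-- A pruning sequence after which no valid pruning is possible any more. -/
def IsCompletePruning {V : Type*} (G : SimpleGraph V) (p : V → Option V) (k : ℕ)
    (ws : List V) : Prop :=
  IsPruningSequence G p k ws ∧ ∀ w, ¬ CanPrune G p k (remaining p ws) w

/-- The subgraph of `G` induced by `H` is a `k`-reduction of `G` from the tree `p`. -/
def IsReduction {V : Type*} (G : SimpleGraph V) (p : V → Option V) (k : ℕ) (H : Set V) : Prop :=
  ∃ ws, IsCompletePruning G p k ws ∧ H = remaining p ws

open Classical in
/-- The last of the successive sets of remaining vertices that contains `v` (the final one if `v`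
is never deleted). -/
noncomputable def lastAlive {V : Type*} (p : V → Option V) (ws : List V) (v : V) : Set V :=
  remaining p (ws.takeWhile fun w => ¬ IsAncestor p w v)

/-- `u` and `v` have the same end type: the last type that `u` has had in the pruning sequence
equals the last type that `v` has had. -/
def SameEndType {V : Type*} (G : SimpleGraph V) (p : V → Option V) (ws : List V)
    (u v : V) : Prop :=
  SameType G p (lastAlive p ws u) u (lastAlive p ws v) v

/-! ### Local certification -/

/-- What a vertex shows to its neighbours: its identifier, its input (the identifier of its
parent in the tree, and whether it belongs to `H`), and its certificate. -/
structure NodeInfo where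
  id : ℕ
  parentId : Option ℕ
  inH : Prop
  cert : List Bool

/-- The decision of a vertex, depending on its own information and on that of its neighbours. -/
abbrev Verifier := NodeInfo → Set NodeInfo → Prop

def nodeInfo {V : Type*} (ids : V → ℕ) (p : V → Option V) (H : Set V) (cert : V → List Bool)
    (v : V) : NodeInfo :=
  ⟨ids v, (p v).map ids, v ∈ H, cert v⟩

/-- The vertex `v` accepts. -/
def Accepts {V : Type*} (A : Verifier) (G : SimpleGraph V) (ids : V → ℕ) (p : V → Option V)
    (H : Set V) (cert : V → List Bool) (v : V) : Prop :=
  A (nodeInfo ids p H cert v) (nodeInfo ids p H cert '' G.neighborSet v)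

/-- What a certificate says about one ancestor: its identifier, whether it has been pruned, and
a label for its end type. -/
structure AncestorRecord where
  id : ℕ
  pruned : Bool
  endType : ℕ

/-- Read through the decoder `dec`, the certificate of each vertex lists, for each of its ancestors
from itself to the root, the identifier, the pruning bit and the end type in the pruning
sequence `ws`. The number `L a` is the label of the end type of `a`. -/
def Records {V : Type*} (dec : List Bool → List AncestorRecord) (G : SimpleGraph V) (ids : V → ℕ)
    (p : V → Option V) (ws : List V) (cert : V → List Bool) : Prop :=
  ∃ L : V → ℕ, (∀ a b, L a = L b ↔ SameEndType G p ws a b) ∧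
    ∀ v, List.Forall₂
      (fun a r => r.id = ids a ∧ (r.pruned = true ↔ a ∈ ws) ∧ r.endType = L a)
      (ancestorList p v) (dec (cert v))

end KernelCert

/-!
Every vertex receives, for each of its ancestors `a` in the tree, a record of `a` (identifier,
pruning bit, code of the end type) and a distance towards the exit of the subtree rooted at `a`.

*The tree.* In a coherent model every subtree induces a connected subgraph of `G`
(`IsCoherent.reachable`), and the subtree of a child `a` of `u` contains a neighbour of `u`, its
exit. Distances to the exit inside the subtree, of `O(log n)` bits, let every vertex of the subtree
check that some neighbour in the same subtree is closer to the exit, or that it sees `u` itself.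
Conversely, following decreasing distances shows that `a` has a descendant adjacent to the vertex
that the certificate of `a` announces as its parent. If moreover the lists of records of adjacent
vertices are always suffixes of one another, then the list of every vertex is made of its own
record and of the list of its parent, and the tree is a coherent model (`isModel_of_treeCheck`).

*The pruning.* By coherence every vertex sees, in the certificates of its neighbours, the records
of all its children. This suffices because end types are determined from the leaves upwards: when
a vertex loses its last type, the children it still has are those that are not roots of removed
subtrees, and their types are their end types (`IsPruningSequence.sameEndType_iff`). A function that
codes at each vertex the ancestor vector and the multiset of the codes of the kept children
separates exactly the isomorphism classes (`IsTypeCode.eq_iff`). Since prunings are made at the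
largest possible depth, their depths never increase, and the types of the siblings of a removed
vertex are already their end types (`IsPruningSequence.invariant`). So a set of vertices is the set
of roots of the subtrees removed by a complete pruning sequence iff, among the children of each
vertex, at most `k` of each end type are kept, and exactly `k` when one of that end type is removed
(`IsCompletePruning.isBalanced`, `IsBalanced.exists_isCompletePruning`). These conditions are local,
and they also bound the number of end types in terms of `k` and `t` alone
(`IsTypeCode.le_codeBound`), which bounds the size of the labels.
-/

namespace KernelCert

/-! ### Rooted trees -/

section Trees

variable {V : Type*} {p : V → Option V}

theorem up_add (v : V) (m n : ℕ) : up p v (m + n) = (up p v m).bind fun u => up p u n := by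
  induction n with
  | zero => simp [up]
  | succ n ih =>
    rw [← Nat.add_assoc, up, ih, Option.bind_assoc]
    rfl

theorem up_succ_of_parent {v u : V} (h : p v = some u) (n : ℕ) : up p v (n + 1) = up p u n := by
  rw [Nat.add_comm, up_add]
  simp [up, h]

theorem up_succ_of_root {v : V} (h : p v = none) (n : ℕ) : up p v (n + 1) = none := by
  rw [Nat.add_comm, up_add]
  simp [up, h]

theorem IsAncestor.refl (v : V) : IsAncestor p v v := ⟨0, rfl⟩

theorem IsAncestor.trans {a b c : V} (hab : IsAncestor p a b) (hbc : IsAncestor p b c) :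
    IsAncestor p a c := by
  obtain ⟨m, hm⟩ := hab
  obtain ⟨n, hn⟩ := hbc
  exact ⟨n + m, by rw [up_add, hn]; exact hm⟩

theorem isAncestor_of_parent {v u : V} (h : p v = some u) : IsAncestor p u v :=
  ⟨1, by simp [up, h]⟩

theorem isAncestor_iff_of_parent {a v u : V} (h : p v = some u) :
    IsAncestor p a v ↔ a = v ∨ IsAncestor p a u := by
  constructor
  · rintro ⟨n, hn⟩
    cases n with
    | zero => exact Or.inl (Option.some.inj hn).symm
    | succ n => exact Or.inr ⟨n, by rw [← up_succ_of_parent h, hn]⟩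
  · rintro (rfl | h')
    · exact IsAncestor.refl _
    · exact h'.trans (isAncestor_of_parent h)

theorem isAncestor_iff_of_root {a v : V} (h : p v = none) : IsAncestor p a v ↔ a = v := by
  constructor
  · rintro ⟨n, hn⟩
    cases n with
    | zero => exact (Option.some.inj hn).symm
    | succ n => simp [up_succ_of_root h] at hn
  · rintro rfl
    exact IsAncestor.refl _

theorem IsAncestor.total {a b v : V} (ha : IsAncestor p a v) (hb : IsAncestor p b v) :
    IsAncestor p a b ∨ IsAncestor p b a := by
  obtain ⟨m, hm⟩ := ha
  obtain ⟨n, hn⟩ := hb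
  rcases Nat.le_total m n with h | h
  · obtain ⟨r, rfl⟩ := Nat.exists_eq_add_of_le h
    rw [up_add, hm] at hn
    exact Or.inr ⟨r, hn⟩
  · obtain ⟨r, rfl⟩ := Nat.exists_eq_add_of_le h
    rw [up_add, hn] at hm
    exact Or.inl ⟨r, hm⟩

/-- The parent map `p` has no cycle and no infinite ascending path: it describes a rooted
forest. -/
def IsForest (p : V → Option V) : Prop := ∀ v, ∃ n, up p v (n + 1) = none

theorem IsModel.isForest {G : SimpleGraph V} {t : ℕ} (h : IsModel G p t) : IsForest p :=
  fun v => let ⟨d, _, hd⟩ := h.depth_le v; ⟨d, hd⟩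

/-- Induction along a rooted forest, from the roots to the leaves. -/
theorem IsForest.induction (hp : IsForest p) {P : V → Prop} (root : ∀ v, p v = none → P v)
    (child : ∀ v u, p v = some u → P u → P v) (v : V) : P v := by
  obtain ⟨n, hn⟩ := hp v
  induction n generalizing v with
  | zero => exact root v (by simpa [up] using hn)
  | succ n ih =>
    cases h : p v with
    | none => exact root v h
    | some u => exact child v u h (ih u (by rwa [up_succ_of_parent h] at hn))

theorem depth_of_root {v : V} (h : p v = none) : depth p v = 0 :=
  Nat.le_zero.1 (Nat.sInf_le (by simp [up, h]))

theorem IsForest.up_depth (hp : IsForest p) (v : V) : up p v (depth p v + 1) = none :=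
  Nat.sInf_mem (s := {n | up p v (n + 1) = none}) (hp v)

theorem IsForest.depth_of_parent (hp : IsForest p) {v u : V} (h : p v = some u) :
    depth p v = depth p u + 1 := by
  apply le_antisymm
  · exact Nat.sInf_le (by
      show up p v (depth p u + 1 + 1) = none
      rw [up_succ_of_parent h, hp.up_depth])
  · have h1 := hp.up_depth v
    rw [up_succ_of_parent h] at h1
    cases hd : depth p v with
    | zero => rw [hd] at h1; simp [up] at h1
    | succ d =>
      rw [hd] at h1
      exact Nat.succ_le_succ (Nat.sInf_le h1)

theorem IsModel.depth_le' {G : SimpleGraph V} {t : ℕ} (h : IsModel G p t) (v : V) :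
    depth p v ≤ t :=
  let ⟨_, hd, hd'⟩ := h.depth_le v; (Nat.sInf_le hd').trans hd

theorem IsForest.eq_or_depth_lt (hp : IsForest p) {a v : V} (h : IsAncestor p a v) :
    a = v ∨ depth p a < depth p v := by
  induction v using hp.induction with
  | root v hv => exact Or.inl ((isAncestor_iff_of_root hv).1 h)
  | child v u hv ih =>
    rcases (isAncestor_iff_of_parent hv).1 h with h | h
    · exact Or.inl h
    · right
      rw [hp.depth_of_parent hv]
      rcases ih h with rfl | h
      · exact Nat.lt_succ_self _
      · omega

theorem IsForest.depth_le_depth (hp : IsForest p) {a v : V} (h : IsAncestor p a v) :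
    depth p a ≤ depth p v := by
  rcases hp.eq_or_depth_lt h with rfl | h
  · exact le_rfl
  · exact h.le

theorem IsForest.eq_of_depth_le (hp : IsForest p) {a v : V} (h : IsAncestor p a v)
    (hd : depth p v ≤ depth p a) : a = v :=
  (hp.eq_or_depth_lt h).resolve_right (by omega)

theorem IsForest.not_isAncestor_parent (hp : IsForest p) {v u : V} (h : p v = some u) :
    ¬ IsAncestor p v u := fun h' => by
  have := hp.depth_le_depth h'
  rw [hp.depth_of_parent h] at this
  omega

theorem IsForest.exists_child (hp : IsForest p) {u x : V} (h : IsAncestor p u x) (hne : x ≠ u) :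
    ∃ w, p w = some u ∧ IsAncestor p w x := by
  induction x using hp.induction with
  | root v hv => exact absurd ((isAncestor_iff_of_root hv).1 h).symm hne
  | child v y hv ih =>
    rcases (isAncestor_iff_of_parent hv).1 h with h | h
    · exact absurd h.symm hne
    · by_cases hy : y = u
      · exact ⟨v, hy ▸ hv, IsAncestor.refl v⟩
      · obtain ⟨w, hw, hwy⟩ := ih h hy
        exact ⟨w, hw, hwy.trans (isAncestor_of_parent hv)⟩

theorem IsForest.eq_of_depth_eq (hp : IsForest p) {a b x : V} (ha : IsAncestor p a x)
    (hb : IsAncestor p b x) (hd : depth p a = depth p b) : a = b := by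
  rcases ha.total hb with h | h
  · exact hp.eq_of_depth_le h hd.ge
  · exact (hp.eq_of_depth_le h hd.le).symm

theorem IsForest.child_unique (hp : IsForest p) {u w w' x : V} (hw : p w = some u)
    (hw' : p w' = some u) (h : IsAncestor p w x) (h' : IsAncestor p w' x) : w = w' :=
  hp.eq_of_depth_eq h h' (by rw [hp.depth_of_parent hw, hp.depth_of_parent hw'])

theorem ancestorList_of_root {v : V} (h : p v = none) : ancestorList p v = [v] := by
  simp [ancestorList, depth_of_root h, up]

theorem IsForest.ancestorList_of_parent (hp : IsForest p) {v u : V} (h : p v = some u) :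
    ancestorList p v = v :: ancestorList p u := by
  have : (up p v ∘ Nat.succ) = up p u := funext fun n => up_succ_of_parent h n
  rw [ancestorList, hp.depth_of_parent h, List.range_succ_eq_map]
  simp [List.filterMap_map, this, up, ancestorList]

theorem IsForest.ancestorList_eq_cons (hp : IsForest p) (v : V) :
    ∃ l, ancestorList p v = v :: l := by
  cases h : p v with
  | none => exact ⟨[], ancestorList_of_root h⟩
  | some u => exact ⟨_, hp.ancestorList_of_parent h⟩

theorem IsForest.length_ancestorList (hp : IsForest p) (v : V) :
    (ancestorList p v).length = depth p v + 1 := by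
  induction v using hp.induction with
  | root v hv => simp [ancestorList_of_root hv, depth_of_root hv]
  | child v u hv ih => simp [hp.ancestorList_of_parent hv, hp.depth_of_parent hv, ih]

theorem IsForest.mem_ancestorList (hp : IsForest p) {a v : V} :
    a ∈ ancestorList p v ↔ IsAncestor p a v := by
  induction v using hp.induction with
  | root v hv => simp [ancestorList_of_root hv, isAncestor_iff_of_root hv]
  | child v u hv ih =>
    simp [hp.ancestorList_of_parent hv, isAncestor_iff_of_parent hv, ih]

theorem IsForest.ancestorList_injective (hp : IsForest p) :
    Function.Injective (ancestorList p) := fun a b h => by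
  obtain ⟨l, hl⟩ := hp.ancestorList_eq_cons a
  obtain ⟨l', hl'⟩ := hp.ancestorList_eq_cons b
  rw [hl, hl'] at h
  exact (List.cons.inj h).1

/-- The suffixes of the list of ancestors of `v` are the lists of ancestors of the ancestors
of `v`. -/
theorem IsForest.suffix_ancestorList (hp : IsForest p) {l : List V} {v : V}
    (h : l <:+ ancestorList p v) (hl : l ≠ []) :
    ∃ a, IsAncestor p a v ∧ l = ancestorList p a := by
  induction v using hp.induction with
  | root v hv =>
    rw [ancestorList_of_root hv, List.suffix_cons_iff] at h
    rcases h with h | h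
    · exact ⟨v, IsAncestor.refl v, by rw [h, ancestorList_of_root hv]⟩
    · exact absurd (List.suffix_nil.1 h) hl
  | child v u hv ih =>
    rw [hp.ancestorList_of_parent hv, List.suffix_cons_iff] at h
    rcases h with h | h
    · exact ⟨v, IsAncestor.refl v, by rw [h, hp.ancestorList_of_parent hv]⟩
    · obtain ⟨a, ha, hla⟩ := ih h
      exact ⟨a, ha.trans (isAncestor_of_parent hv), hla⟩

theorem IsForest.ancestorList_suffix_iff (hp : IsForest p) {a v : V} :
    ancestorList p a <:+ ancestorList p v ↔ IsAncestor p a v := by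
  constructor
  · intro h
    obtain ⟨l, hl⟩ := hp.ancestorList_eq_cons a
    obtain ⟨b, hb, hab⟩ := hp.suffix_ancestorList h (by simp [hl])
    rwa [hp.ancestorList_injective hab]
  · intro h
    induction v using hp.induction with
    | root v hv => rw [(isAncestor_iff_of_root hv).1 h]
    | child v u hv ih =>
      rcases (isAncestor_iff_of_parent hv).1 h with rfl | h
      · exact List.suffix_refl _
      · rw [hp.ancestorList_of_parent hv]
        exact (ih h).trans (List.suffix_cons _ _)

end Trees

/-! ### Isomorphisms of pruned subtrees -/

section Types

variable {V : Type*} {G : SimpleGraph V} {p : V → Option V}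

theorem SameAncestorVector.symm {u v : V} (h : SameAncestorVector G p u v) :
    SameAncestorVector G p v u :=
  ⟨h.1.symm, fun j hj => (h.2 j (h.1 ▸ hj)).symm⟩

theorem SameAncestorVector.trans {u v w : V} (h : SameAncestorVector G p u v)
    (h' : SameAncestorVector G p v w) : SameAncestorVector G p u w :=
  ⟨h.1.trans h'.1, fun j hj => (h.2 j hj).trans (h'.2 j (h.1 ▸ hj))⟩

/-- The maps `f` and `g` restrict to mutually inverse isomorphisms between the tree induced on `A`
and rooted at `u` and the tree induced on `B` and rooted at `v`, which preserve the ancestor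
vectors. Total maps of `V` are used rather than an equivalence of subtypes because they are easier
to restrict and to glue. -/
structure IsTreeIso (G : SimpleGraph V) (p : V → Option V) (A : Set V) (u : V) (B : Set V) (v : V)
    (f g : V → V) : Prop where
  mapsTo : ∀ x ∈ A, f x ∈ B
  mapsTo_symm : ∀ y ∈ B, g y ∈ A
  left_inv : ∀ x ∈ A, g (f x) = x
  right_inv : ∀ y ∈ B, f (g y) = y
  map_root : f u = v
  map_parent : ∀ x ∈ A, ∀ y ∈ A, p x = some y ↔ p (f x) = some (f y)
  map_vector : ∀ x ∈ A, SameAncestorVector G p x (f x)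

theorem IsTreeIso.symm {A B : Set V} {u v : V} {f g : V → V} (hu : u ∈ A)
    (h : IsTreeIso G p A u B v f g) : IsTreeIso G p B v A u g f where
  mapsTo := h.mapsTo_symm
  mapsTo_symm := h.mapsTo
  left_inv := h.right_inv
  right_inv := h.left_inv
  map_root := by rw [← h.map_root, h.left_inv u hu]
  map_parent x hx y hy := by
    rw [h.map_parent _ (h.mapsTo_symm x hx) _ (h.mapsTo_symm y hy), h.right_inv x hx,
      h.right_inv y hy]
  map_vector x hx := by
    have := h.map_vector _ (h.mapsTo_symm x hx)
    rw [h.right_inv x hx] at this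
    exact this.symm

theorem IsTreeIso.trans {A B C : Set V} {u v w : V} {f g f' g' : V → V}
    (h : IsTreeIso G p A u B v f g) (h' : IsTreeIso G p B v C w f' g') :
    IsTreeIso G p A u C w (f' ∘ f) (g ∘ g') where
  mapsTo x hx := h'.mapsTo _ (h.mapsTo x hx)
  mapsTo_symm y hy := h.mapsTo_symm _ (h'.mapsTo_symm y hy)
  left_inv x hx := by simp [h'.left_inv _ (h.mapsTo x hx), h.left_inv x hx]
  right_inv y hy := by simp [h.right_inv _ (h'.mapsTo_symm y hy), h'.right_inv y hy]
  map_root := by simp [h.map_root, h'.map_root]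
  map_parent x hx y hy :=
    (h.map_parent x hx y hy).trans (h'.map_parent _ (h.mapsTo x hx) _ (h.mapsTo y hy))
  map_vector x hx := (h.map_vector x hx).trans (h'.map_vector _ (h.mapsTo x hx))

/-- The subtree rooted at `v` once the subtrees rooted at those vertices of `W` that are strictly
below `v` have been removed. -/
def prunedSubtree (p : V → Option V) (W : Set V) (v : V) : Set V :=
  {x | IsAncestor p v x ∧ ∀ w ∈ W, IsAncestor p w x → IsAncestor p w v}

/-- `u` and `v` have the same type after the removal of the subtrees rooted at the vertices of
`W`; this is meaningful even when `u` or `v` is itself removed. -/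
def SameTypeOff (G : SimpleGraph V) (p : V → Option V) (W : Set V) (u v : V) : Prop :=
  ∃ f g, IsTreeIso G p (prunedSubtree p W u) u (prunedSubtree p W v) v f g

theorem self_mem_prunedSubtree (W : Set V) (v : V) : v ∈ prunedSubtree p W v :=
  ⟨IsAncestor.refl v, fun _ _ h => h⟩

theorem SameTypeOff.refl (W : Set V) (u : V) : SameTypeOff G p W u u :=
  ⟨id, id, by constructor <;> simp [SameAncestorVector]⟩

theorem SameTypeOff.symm {W : Set V} {u v : V} (h : SameTypeOff G p W u v) :
    SameTypeOff G p W v u :=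
  let ⟨f, g, h⟩ := h
  ⟨g, f, h.symm (self_mem_prunedSubtree W u)⟩

theorem SameTypeOff.trans {W : Set V} {u v w : V} (h : SameTypeOff G p W u v)
    (h' : SameTypeOff G p W v w) : SameTypeOff G p W u w :=
  let ⟨f, g, h⟩ := h
  let ⟨f', g', h'⟩ := h'
  ⟨f' ∘ f, g ∘ g', h.trans h'⟩

theorem SameTypeOff.congr {W W' : Set V} {u v : V}
    (hu : prunedSubtree p W u = prunedSubtree p W' u)
    (hv : prunedSubtree p W v = prunedSubtree p W' v) :
    SameTypeOff G p W u v ↔ SameTypeOff G p W' u v := by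
  rw [SameTypeOff, SameTypeOff, hu, hv]

/-- The equivalence of subtypes in the definition of `SameType` is the same thing as an isomorphism
given by total maps. -/
theorem sameType_iff_exists_isTreeIso {S S' A B : Set V} {u v : V} (hu : u ∈ A)
    (hA : ∀ x, x ∈ A ↔ x ∈ S ∧ IsAncestor p u x)
    (hB : ∀ x, x ∈ B ↔ x ∈ S' ∧ IsAncestor p v x) :
    SameType G p S u S' v ↔ ∃ f g, IsTreeIso G p A u B v f g := by
  classical
  obtain rfl : A = {x | x ∈ S ∧ IsAncestor p u x} := Set.ext hA
  obtain rfl : B = {x | x ∈ S' ∧ IsAncestor p v x} := Set.ext hB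
  constructor
  · rintro ⟨e, hroot, hparent, hvec⟩
    have key : ∀ x (h : x ∈ {x | x ∈ S ∧ IsAncestor p u x}),
        (if h : x ∈ {x | x ∈ S ∧ IsAncestor p u x} then (e ⟨x, h⟩).1 else x) = (e ⟨x, h⟩).1 :=
      fun x h => dif_pos h
    have key' : ∀ x (h : x ∈ {x | x ∈ S' ∧ IsAncestor p v x}),
        (if h : x ∈ {x | x ∈ S' ∧ IsAncestor p v x} then (e.symm ⟨x, h⟩).1 else x)
          = (e.symm ⟨x, h⟩).1 :=
      fun x h => dif_pos h
    refine ⟨fun x => if h : x ∈ {x | x ∈ S ∧ IsAncestor p u x} then (e ⟨x, h⟩).1 else x,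
      fun x => if h : x ∈ {x | x ∈ S' ∧ IsAncestor p v x} then (e.symm ⟨x, h⟩).1 else x,
      ?_, ?_, ?_, ?_, ?_, ?_, ?_⟩
    · intro x hx
      simp only [key x hx]
      exact (e ⟨x, hx⟩).2
    · intro x hx
      simp only [key' x hx]
      exact (e.symm ⟨x, hx⟩).2
    · intro x hx
      simp only [key x hx]
      rw [key' _ (e ⟨x, hx⟩).2]
      exact congrArg Subtype.val (e.symm_apply_apply ⟨x, hx⟩)
    · intro x hx
      simp only [key' x hx]
      rw [key _ (e.symm ⟨x, hx⟩).2]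
      exact congrArg Subtype.val (e.apply_symm_apply ⟨x, hx⟩)
    · simp only [key u hu]
      exact (hroot ⟨u, hu⟩).1 rfl
    · intro x hx y hy
      simp only [key x hx, key y hy]
      exact hparent ⟨x, hx⟩ ⟨y, hy⟩
    · intro x hx
      simp only [key x hx]
      exact hvec ⟨x, hx⟩
  · rintro ⟨f, g, h⟩
    refine ⟨⟨fun x => ⟨f x.1, h.mapsTo _ x.2⟩, fun y => ⟨g y.1, h.mapsTo_symm _ y.2⟩,
      fun x => Subtype.ext (h.left_inv _ x.2), fun y => Subtype.ext (h.right_inv _ y.2)⟩,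
      fun x => ?_, fun x y => h.map_parent _ x.2 _ y.2, fun x => h.map_vector _ x.2⟩
    constructor
    · intro hx
      show f x.1 = v
      rw [hx, h.map_root]
    · intro hx
      rw [← h.left_inv _ x.2, show f x.1 = v from hx, ← h.map_root, h.left_inv _ hu]

variable {W : Set V}

theorem IsForest.notMem_of_mem_prunedSubtree (hp : IsForest p) {v x : V}
    (hx : x ∈ prunedSubtree p W v) (hne : x ≠ v) : x ∉ W := fun hW =>
  hne (hp.eq_of_depth_le (hx.2 x hW (IsAncestor.refl x)) (hp.depth_le_depth hx.1))

/-- Pruned subtrees decompose along the children that have not been removed. -/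
theorem IsForest.mem_prunedSubtree_iff (hp : IsForest p) {v x : V} :
    x ∈ prunedSubtree p W v ↔
      x = v ∨ ∃ w, p w = some v ∧ w ∉ W ∧ x ∈ prunedSubtree p W w := by
  constructor
  · intro hx
    by_cases hxv : x = v
    · exact Or.inl hxv
    obtain ⟨w, hw, hwx⟩ := hp.exists_child hx.1 hxv
    refine Or.inr ⟨w, hw, fun hW => hp.not_isAncestor_parent hw (hx.2 w hW hwx), hwx,
      fun w' hw' hx' => (hx.2 w' hw' hx').trans (isAncestor_of_parent hw)⟩
  · rintro (rfl | ⟨w, hw, hW, hx⟩)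
    · exact self_mem_prunedSubtree W x
    · refine ⟨(isAncestor_of_parent hw).trans hx.1, fun w' hw' hx' => ?_⟩
      rcases (isAncestor_iff_of_parent hw).1 (hx.2 w' hw' hx') with rfl | h
      · exact absurd hw' hW
      · exact h

theorem mem_prunedSubtree_trans {u v x : V} (hv : v ∈ prunedSubtree p W u)
    (hx : x ∈ prunedSubtree p W v) : x ∈ prunedSubtree p W u :=
  ⟨hv.1.trans hx.1, fun w hw h => hv.2 w hw (hx.2 w hw h)⟩

theorem IsForest.mem_prunedSubtree_of_parent (hp : IsForest p) {v x y : V} (h : p x = some y)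
    (hy : y ∈ prunedSubtree p W v) (hx : x ∉ W) : x ∈ prunedSubtree p W v :=
  mem_prunedSubtree_trans hy
    (hp.mem_prunedSubtree_iff.2 (Or.inr ⟨x, h, hx, self_mem_prunedSubtree W x⟩))

theorem IsTreeIso.mapsTo_prunedSubtree (hp : IsForest p) {u v w : V} {f g : V → V}
    (h : IsTreeIso G p (prunedSubtree p W u) u (prunedSubtree p W v) v f g)
    (hw : w ∈ prunedSubtree p W u) :
    ∀ x ∈ prunedSubtree p W w, f x ∈ prunedSubtree p W (f w) := by
  intro x hx
  induction x using hp.induction with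
  | root x hx' =>
    rw [(isAncestor_iff_of_root hx').1 hx.1]
    exact self_mem_prunedSubtree W _
  | child x y hxy ih =>
    by_cases hxw : x = w
    · rw [hxw]
      exact self_mem_prunedSubtree W _
    have hy : y ∈ prunedSubtree p W w := by
      rcases (isAncestor_iff_of_parent hxy).1 hx.1 with h' | h'
      · exact absurd h'.symm hxw
      · exact ⟨h', fun w' hw' hw'y => hx.2 w' hw' (hw'y.trans (isAncestor_of_parent hxy))⟩
    have hxu := mem_prunedSubtree_trans hw hx
    have hyu := mem_prunedSubtree_trans hw hy
    have hf := (h.map_parent x hxu y hyu).1 hxy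
    refine hp.mem_prunedSubtree_of_parent hf (ih hy)
      (hp.notMem_of_mem_prunedSubtree (h.mapsTo x hxu) fun hv => ?_)
    rw [hv] at hf
    exact hp.not_isAncestor_parent hf (h.mapsTo y hyu).1

/-- An isomorphism of pruned subtrees restricts to the subtree of each of the vertices. -/
theorem IsTreeIso.restrict (hp : IsForest p) {u v w : V} {f g : V → V}
    (h : IsTreeIso G p (prunedSubtree p W u) u (prunedSubtree p W v) v f g)
    (hw : w ∈ prunedSubtree p W u) :
    IsTreeIso G p (prunedSubtree p W w) w (prunedSubtree p W (f w)) (f w) f g where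
  mapsTo := h.mapsTo_prunedSubtree hp hw
  mapsTo_symm := by
    have := (h.symm (self_mem_prunedSubtree W u)).mapsTo_prunedSubtree hp (h.mapsTo w hw)
    rwa [h.left_inv w hw] at this
  left_inv x hx := h.left_inv x (mem_prunedSubtree_trans hw hx)
  right_inv y hy := h.right_inv y (mem_prunedSubtree_trans (h.mapsTo w hw) hy)
  map_root := rfl
  map_parent x hx y hy :=
    h.map_parent x (mem_prunedSubtree_trans hw hx) y (mem_prunedSubtree_trans hw hy)
  map_vector x hx := h.map_vector x (mem_prunedSubtree_trans hw hx)

theorem IsForest.child_mem_prunedSubtree (hp : IsForest p) {u w : V} (hw : p w = some u)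
    (hW : w ∉ W) : w ∈ prunedSubtree p W u :=
  hp.mem_prunedSubtree_iff.2 (Or.inr ⟨w, hw, hW, self_mem_prunedSubtree W w⟩)

theorem IsTreeIso.map_child (hp : IsForest p) {u v w : V} {f g : V → V}
    (h : IsTreeIso G p (prunedSubtree p W u) u (prunedSubtree p W v) v f g)
    (hw : p w = some u) (hW : w ∉ W) : p (f w) = some v ∧ f w ∉ W := by
  have hwu := hp.child_mem_prunedSubtree hw hW
  have hf := (h.map_parent w hwu u (self_mem_prunedSubtree W u)).1 hw
  rw [h.map_root] at hf
  refine ⟨hf, hp.notMem_of_mem_prunedSubtree (h.mapsTo w hwu) fun hv => ?_⟩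
  rw [hv] at hf
  exact hp.not_isAncestor_parent hf (IsAncestor.refl v)

/-- Isomorphisms between the subtrees of the children of `u` and those of the children of `v` glue
to an isomorphism between the subtrees of `u` and `v`. -/
theorem IsForest.sameTypeOff_of_children (hp : IsForest p) {u v : V}
    (hvec : SameAncestorVector G p u v)
    (σ : {w // p w = some u ∧ w ∉ W} ≃ {w // p w = some v ∧ w ∉ W})
    (hσ : ∀ w, SameTypeOff G p W w.1 (σ w).1) : SameTypeOff G p W u v := by
  classical
  choose F K hFK using hσ
  have hex : ∀ a x, x ∈ prunedSubtree p W a → x ≠ a →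
      ∃ w : {w // p w = some a ∧ w ∉ W}, x ∈ prunedSubtree p W w.1 := fun a x hx hne => by
    obtain ⟨w, hw, hW, hxw⟩ := (hp.mem_prunedSubtree_iff.1 hx).resolve_left hne
    exact ⟨⟨w, hw, hW⟩, hxw⟩
  have huniq : ∀ a x (w w' : {w // p w = some a ∧ w ∉ W}), x ∈ prunedSubtree p W w.1 →
      x ∈ prunedSubtree p W w'.1 → w = w' := fun a x w w' h h' =>
    Subtype.ext (hp.child_unique w.2.1 w'.2.1 h.1 h'.1)
  have hne : ∀ a x (w : {w // p w = some a ∧ w ∉ W}), x ∈ prunedSubtree p W w.1 → x ≠ a := by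
    rintro a x w h rfl
    exact hp.not_isAncestor_parent w.2.1 h.1
  -- outside the root, `f` and `g` act as the isomorphism of the subtree of the child above
  let f : V → V := fun x => if h : ∃ w : {w // p w = some u ∧ w ∉ W}, x ∈ prunedSubtree p W w.1
    then F h.choose x else v
  let g : V → V := fun y => if h : ∃ w : {w // p w = some v ∧ w ∉ W}, y ∈ prunedSubtree p W w.1
    then K (σ.symm h.choose) y else u
  have hf : ∀ (w : {w // p w = some u ∧ w ∉ W}) x, x ∈ prunedSubtree p W w.1 → f x = F w x := by
    intro w x hx
    have h : ∃ w : {w // p w = some u ∧ w ∉ W}, x ∈ prunedSubtree p W w.1 := ⟨w, hx⟩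
    simp only [f, dif_pos h]
    rw [huniq u x _ _ h.choose_spec hx]
  have hg : ∀ (w : {w // p w = some u ∧ w ∉ W}) y, y ∈ prunedSubtree p W (σ w).1 →
      g y = K w y := by
    intro w y hy
    have h : ∃ w : {w // p w = some v ∧ w ∉ W}, y ∈ prunedSubtree p W w.1 := ⟨σ w, hy⟩
    simp only [g, dif_pos h]
    rw [huniq v y _ _ h.choose_spec hy, σ.symm_apply_apply]
  have hfu : f u = v := dif_neg fun ⟨w, hw⟩ => hne u u w hw rfl
  have hgv : g v = u := dif_neg fun ⟨w, hw⟩ => hne v v w hw rfl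
  have hsub : ∀ a (w : {w // p w = some a ∧ w ∉ W}) x, x ∈ prunedSubtree p W w.1 →
      x ∈ prunedSubtree p W a := fun a w x hx =>
    mem_prunedSubtree_trans (hp.child_mem_prunedSubtree w.2.1 w.2.2) hx
  -- a vertex strictly below `a` has its parent in the subtree of the same child or equal to `a`
  have hup : ∀ a x y (w : {w // p w = some a ∧ w ∉ W}), x ∈ prunedSubtree p W w.1 →
      p x = some y → x = w.1 ∧ y = a ∨ x ≠ w.1 ∧ y ∈ prunedSubtree p W w.1 := by
    intro a x y w hx hxy
    by_cases hxw : x = w.1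
    · left
      rw [hxw, w.2.1] at hxy
      exact ⟨hxw, (Option.some.inj hxy).symm⟩
    · right
      rcases (isAncestor_iff_of_parent hxy).1 hx.1 with h | h
      · exact absurd h.symm hxw
      · exact ⟨hxw, h, fun w' hw' h' => hx.2 w' hw' (h'.trans (isAncestor_of_parent hxy))⟩
  refine ⟨f, g, ?_, ?_, ?_, ?_, hfu, ?_, ?_⟩
  · intro x hx
    by_cases hxu : x = u
    · rw [hxu, hfu]; exact self_mem_prunedSubtree W v
    · obtain ⟨w, hxw⟩ := hex u x hx hxu
      rw [hf w x hxw]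
      exact hsub v _ _ ((hFK w).mapsTo x hxw)
  · intro y hy
    by_cases hyv : y = v
    · rw [hyv, hgv]; exact self_mem_prunedSubtree W u
    · obtain ⟨w', hw'⟩ := hex v y hy hyv
      obtain ⟨w, rfl⟩ := σ.surjective w'
      rw [hg w y hw']
      exact hsub u _ _ ((hFK w).mapsTo_symm y hw')
  · intro x hx
    by_cases hxu : x = u
    · rw [hxu, hfu, hgv]
    · obtain ⟨w, hxw⟩ := hex u x hx hxu
      rw [hf w x hxw, hg w _ ((hFK w).mapsTo x hxw), (hFK w).left_inv x hxw]
  · intro y hy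
    by_cases hyv : y = v
    · rw [hyv, hgv, hfu]
    · obtain ⟨w', hw'⟩ := hex v y hy hyv
      obtain ⟨w, rfl⟩ := σ.surjective w'
      rw [hg w y hw', hf w _ ((hFK w).mapsTo_symm y hw'), (hFK w).right_inv y hw']
  · intro x hx y hy
    by_cases hxu : x = u
    · subst hxu
      rw [hfu]
      constructor
      · intro h
        exact absurd hy.1 (hp.not_isAncestor_parent h)
      · intro h
        refine absurd ?_ (hp.not_isAncestor_parent h)
        by_cases hyu : y = x
        · rw [hyu, hfu]; exact IsAncestor.refl v
        · obtain ⟨w, hyw⟩ := hex _ y hy hyu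
          rw [hf w y hyw]
          exact (hsub v _ _ ((hFK w).mapsTo y hyw)).1
    · obtain ⟨w, hxw⟩ := hex u x hx hxu
      have hfx := (hFK w).mapsTo x hxw
      have hroot : F w w.1 = (σ w).1 := (hFK w).map_root
      rw [hf w x hxw]
      constructor
      · intro h
        rcases hup u x y w hxw h with ⟨rfl, rfl⟩ | ⟨_, hyw⟩
        · rw [hfu, hroot]; exact (σ w).2.1
        · rw [hf w y hyw]
          exact ((hFK w).map_parent x hxw y hyw).1 h
      · intro h
        rcases hup v _ _ (σ w) hfx h with ⟨hxr, hyv⟩ | ⟨hxr, hyw⟩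
        · have hxw' : x = w.1 := by
            rw [← (hFK w).left_inv x hxw, hxr, ← hroot,
              (hFK w).left_inv _ (self_mem_prunedSubtree W _)]
          by_cases hyu : y = u
          · rw [hxw', hyu]; exact w.2.1
          · obtain ⟨w', hyw'⟩ := hex u y hy hyu
            rw [hf w' y hyw'] at hyv
            exact absurd hyv (hne v _ (σ w') ((hFK w').mapsTo y hyw'))
        · by_cases hyu : y = u
          · rw [hyu, hfu] at hyw
            exact absurd rfl (hne v _ _ hyw)
          · obtain ⟨w', hyw'⟩ := hex u y hy hyu
            rw [hf w' y hyw'] at hyw h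
            obtain rfl : w' = w :=
              σ.injective (huniq v _ _ _ ((hFK w').mapsTo y hyw') hyw)
            exact ((hFK w').map_parent x hxw y hyw').2 h
  · intro x hx
    by_cases hxu : x = u
    · rw [hxu, hfu]; exact hvec
    · obtain ⟨w, hxw⟩ := hex u x hx hxu
      rw [hf w x hxw]
      exact (hFK w).map_vector x hxw

/-! ### Numerical codes of types -/

open Classical in
/-- The ancestor vector of `v` as a list of bits. -/
noncomputable def vectorBits (G : SimpleGraph V) (p : V → Option V) (v : V) : List Bool :=
  (List.range (depth p v)).map fun j => decide (ancestorVector G p v j)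

theorem vectorBits_eq_iff {u v : V} :
    vectorBits G p u = vectorBits G p v ↔ SameAncestorVector G p u v := by
  constructor
  · intro h
    have hd : depth p u = depth p v := by simpa [vectorBits] using congrArg List.length h
    refine ⟨hd, fun j hj => ?_⟩
    rw [vectorBits, vectorBits, ← hd, List.map_inj_left] at h
    simpa using h j (List.mem_range.2 hj)
  · rintro ⟨hd, h⟩
    rw [vectorBits, vectorBits, ← hd, List.map_inj_left]
    intro j hj
    simpa using h j (List.mem_range.1 hj)

/-- The function `L` assigns to each vertex the code of its ancestor vector and of the multiset of
the values of its children outside `W`: it codes the types after the removal of the subtrees rooted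
at the vertices of `W`. -/
def IsTypeCode (G : SimpleGraph V) (p : V → Option V) (W : Set V) (L : V → ℕ) : Prop :=
  ∀ v, ∃ m : Multiset ℕ, L v = Encodable.encode (vectorBits G p v, m) ∧
    ∀ τ, m.count τ = Set.ncard {w | p w = some v ∧ w ∉ W ∧ L w = τ}

/-- Two families with as many members of each colour are in colour-preserving bijection. -/
theorem exists_equiv_of_ncard_eq {α : Type*} [Finite α] (A B : Set α) (L : α → ℕ)
    (h : ∀ τ, Set.ncard {x | x ∈ A ∧ L x = τ} = Set.ncard {x | x ∈ B ∧ L x = τ}) :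
    ∃ σ : A ≃ B, ∀ a, L (σ a).1 = L a.1 := by
  have key : ∀ τ, Nonempty ({a : A // L a.1 = τ} ≃ {b : B // L b.1 = τ}) := fun τ => by
    have e1 : ∀ C : Set α, Nat.card {a : C // L a.1 = τ} = Set.ncard {x | x ∈ C ∧ L x = τ} :=
      fun C => Nat.card_congr (Equiv.subtypeSubtypeEquivSubtypeInter (· ∈ C) (fun x => L x = τ))
    exact Finite.card_eq.1 (by rw [e1, e1, h τ])
  let e := fun τ => (key τ).some
  refine ⟨((Equiv.sigmaFiberEquiv fun a : A => L a.1).symm.trans (Equiv.sigmaCongrRight e)).trans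
    (Equiv.sigmaFiberEquiv fun b : B => L b.1), fun a => ?_⟩
  exact (e (L a.1) ⟨a, rfl⟩).2

/-- Codes of types are complete invariants. -/
theorem IsTypeCode.eq_iff [Finite V] (hp : IsForest p) {L : V → ℕ} (hL : IsTypeCode G p W L)
    (u v : V) : L u = L v ↔ SameTypeOff G p W u v := by
  obtain ⟨N, hN⟩ : ∃ N, ∀ v, depth p v < N := by
    obtain ⟨N, hN⟩ := (Set.finite_range (depth p)).bddAbove
    exact ⟨N + 1, fun v => Nat.lt_succ_of_le (hN ⟨v, rfl⟩)⟩
  have main : ∀ n u v, N ≤ depth p u + n → (L u = L v ↔ SameTypeOff G p W u v) := by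
    intro n
    induction n with
    | zero => intro u v h; exact absurd (hN u) (by omega)
    | succ n ih =>
      intro u v hn
      have ih' : ∀ w, p w = some u → ∀ w', L w = L w' ↔ SameTypeOff G p W w w' := fun w hw w' =>
        ih w w' (by rw [hp.depth_of_parent hw]; omega)
      obtain ⟨m, hm, hcount⟩ := hL u
      obtain ⟨m', hm', hcount'⟩ := hL v
      rw [hm, hm', Encodable.encode_inj, Prod.mk.injEq, vectorBits_eq_iff]
      constructor
      · rintro ⟨hvec, rfl⟩
        obtain ⟨σ, hσ⟩ := exists_equiv_of_ncard_eq {w | p w = some u ∧ w ∉ W}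
          {w | p w = some v ∧ w ∉ W} L (fun τ => by
            simp only [Set.mem_ofPred_eq, and_assoc]
            rw [← hcount, ← hcount'])
        exact hp.sameTypeOff_of_children hvec σ fun w => (ih' w.1 w.2.1 _).1 (hσ w).symm
      · rintro ⟨f, g, h⟩
        have hsymm := h.symm (self_mem_prunedSubtree W u)
        have hLf : ∀ w, p w = some u → w ∉ W → L (f w) = L w := fun w hw hW =>
          ((ih' w hw _).2 ⟨f, g, h.restrict hp (hp.child_mem_prunedSubtree hw hW)⟩).symm
        refine ⟨h.map_root ▸ h.map_vector u (self_mem_prunedSubtree W u), ?_⟩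
        ext τ
        rw [hcount, hcount']
        refine Set.ncard_congr (fun w _ => f w) ?_ ?_ ?_
        · rintro w ⟨hw, hW, rfl⟩
          obtain ⟨h1, h2⟩ := h.map_child hp hw hW
          exact ⟨h1, h2, hLf w hw hW⟩
        · rintro w w' ⟨hw, hW, _⟩ ⟨hw', hW', _⟩ hww
          rw [← h.left_inv w (hp.child_mem_prunedSubtree hw hW), hww,
            h.left_inv w' (hp.child_mem_prunedSubtree hw' hW')]
        · rintro w ⟨hw, hW, rfl⟩
          obtain ⟨h1, h2⟩ := hsymm.map_child hp hw hW
          have h3 := h.right_inv w (hp.child_mem_prunedSubtree hw hW)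
          exact ⟨g w, ⟨h1, h2, by rw [← hLf _ h1 h2, h3]⟩, h3⟩
  exact main N u v (by omega)

end Types

/-! ### Pruning sequences -/

section Pruning

variable {V : Type*} {G : SimpleGraph V} {p : V → Option V}

theorem mem_remaining_iff_of_parent {ws : List V} {v w : V} (hw : p w = some v)
    (hv : v ∈ remaining p ws) : w ∈ remaining p ws ↔ w ∉ ws := by
  constructor
  · exact fun h hws => h w hws (IsAncestor.refl w)
  · intro h w' hw' ha
    rcases (isAncestor_iff_of_parent hw).1 ha with rfl | ha
    · exact h hw'
    · exact hv w' hw' ha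

theorem mem_remaining_of_isAncestor {ws : List V} {u v : V} (h : IsAncestor p u v)
    (hv : v ∈ remaining p ws) : u ∈ remaining p ws :=
  fun w hw ha => hv w hw (ha.trans h)

theorem mem_prunedSubtree_iff_of_mem_remaining {ws : List V} {v : V} (hv : v ∈ remaining p ws)
    (x : V) : x ∈ prunedSubtree p {w | w ∈ ws} v ↔ x ∈ remaining p ws ∧ IsAncestor p v x := by
  constructor
  · exact fun h => ⟨fun w hw hx => hv w hw (h.2 w hw hx), h.1⟩
  · exact fun h => ⟨h.2, fun w hw hx => absurd hx (h.1 w hw)⟩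

/-- Pruned subtrees depend only on what is removed strictly below their roots. -/
theorem prunedSubtree_congr {W W' : Set V} {v : V}
    (h : ∀ w, IsAncestor p v w → w ≠ v → (w ∈ W ↔ w ∈ W')) :
    prunedSubtree p W v = prunedSubtree p W' v := by
  have key : ∀ W W' : Set V, (∀ w, IsAncestor p v w → w ≠ v → (w ∈ W ↔ w ∈ W')) →
      prunedSubtree p W v ⊆ prunedSubtree p W' v := by
    rintro W W' h x ⟨hx, hx'⟩
    refine ⟨hx, fun w hw hwx => ?_⟩
    rcases hwx.total hx with ha | ha
    · exact ha
    · by_cases hwv : w = v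
      · rw [hwv]; exact IsAncestor.refl v
      · exact hx' w ((h w ha hwv).2 hw) hwx
  exact (key W W' h).antisymm (key W' W fun w h1 h2 => (h w h1 h2).symm)

/-- The number of children of `u` outside `W` with the type of `w`, after the removal of the
subtrees rooted at the vertices of `W`. -/
noncomputable def twinCount (G : SimpleGraph V) (p : V → Option V) (W : Set V) (u w : V) : ℕ :=
  Set.ncard {x | p x = some u ∧ x ∉ W ∧ SameTypeOff G p W w x}

theorem twinCount_congr {W : Set V} {u w w' : V} (h : SameTypeOff G p W w w') :
    twinCount G p W u w = twinCount G p W u w' := by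
  unfold twinCount
  congr 1
  ext x
  exact ⟨fun hx => ⟨hx.1, hx.2.1, h.symm.trans hx.2.2⟩, fun hx => ⟨hx.1, hx.2.1, h.trans hx.2.2⟩⟩

/-- Validity of a pruning, in terms of the removed vertices instead of the remaining ones. -/
theorem canPrune_iff {k : ℕ} {ws : List V} {w : V} :
    CanPrune G p k (remaining p ws) w ↔ w ∈ remaining p ws ∧
      ∃ u, p w = some u ∧ k < twinCount G p {x | x ∈ ws} u w := by
  unfold CanPrune twinCount
  refine and_congr_right fun hw => exists_congr fun u => and_congr_right fun hu => ?_
  have hmem : ∀ x, p x = some u → (x ∈ remaining p ws ↔ x ∉ ws) := fun x hx =>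
    mem_remaining_iff_of_parent hx (mem_remaining_of_isAncestor (isAncestor_of_parent hu) hw)
  have hset : {x | x ∈ remaining p ws ∧ p x = some u ∧
      SameType G p (remaining p ws) w (remaining p ws) x} =
      {x | p x = some u ∧ x ∉ {x | x ∈ ws} ∧ SameTypeOff G p {x | x ∈ ws} w x} := by
    ext x
    constructor
    · rintro ⟨hx, hxu, h⟩
      exact ⟨hxu, (hmem x hxu).1 hx, (sameType_iff_exists_isTreeIso (self_mem_prunedSubtree _ w)
        (mem_prunedSubtree_iff_of_mem_remaining hw)
        (mem_prunedSubtree_iff_of_mem_remaining hx)).1 h⟩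
    · rintro ⟨hxu, hx, h⟩
      have hx := (hmem x hxu).2 hx
      exact ⟨hx, hxu, (sameType_iff_exists_isTreeIso (self_mem_prunedSubtree _ w)
        (mem_prunedSubtree_iff_of_mem_remaining hw)
        (mem_prunedSubtree_iff_of_mem_remaining hx)).2 h⟩
  rw [hset]

theorem IsPruningSequence.pairwise {k : ℕ} {ws : List V} (h : IsPruningSequence G p k ws) :
    ws.Pairwise fun a b => ¬ IsAncestor p a b := by
  induction h with
  | nil => exact List.Pairwise.nil
  | snoc ws w _ hw _ ih =>
    rw [List.pairwise_append]
    refine ⟨ih, List.pairwise_singleton _ _, fun a ha b hb => ?_⟩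
    rw [List.mem_singleton.1 hb]
    exact hw.1 a ha

/-- The end type of a vertex can be read off from the set of all the roots of removed subtrees,
whatever the order of the removals. -/
theorem IsPruningSequence.sameEndType_iff (hp : IsForest p) {k : ℕ} {ws : List V}
    (h : IsPruningSequence G p k ws) (u v : V) :
    SameEndType G p ws u v ↔ SameTypeOff G p {w | w ∈ ws} u v := by
  classical
  have hmem : ∀ v, v ∈ lastAlive p ws v := fun v w hw => by
    have := List.mem_takeWhile_imp hw
    simpa using this
  -- no vertex below a removed one is removed later, so that all the removals strictly below `v`
  -- take place before the deletion of `v`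
  have htake : ∀ v w, IsAncestor p v w → w ≠ v → w ∈ ws →
      w ∈ ws.takeWhile fun w => decide (¬ IsAncestor p w v) := by
    intro v w hvw hne
    have hpw := h.pairwise
    clear h hmem
    induction ws with
    | nil => simp
    | cons b l ih =>
      intro hw
      rw [List.pairwise_cons] at hpw
      by_cases hb : IsAncestor p b v
      · rcases List.mem_cons.1 hw with rfl | hw
        · exact absurd (hp.eq_of_depth_le hb (hp.depth_le_depth hvw)) hne
        · exact absurd (hb.trans hvw) (hpw.1 w hw)
      · rw [List.takeWhile_cons_of_pos (by simpa using hb)]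
        rcases List.mem_cons.1 hw with rfl | hw
        · exact List.mem_cons_self
        · exact List.mem_cons_of_mem _ (ih hpw.2 hw)
  have hsub : ∀ v x, x ∈ prunedSubtree p {w | w ∈ ws} v ↔
      x ∈ lastAlive p ws v ∧ IsAncestor p v x := fun v x => by
    rw [lastAlive, ← mem_prunedSubtree_iff_of_mem_remaining (hmem v), prunedSubtree_congr]
    intro w hvw hne
    refine ⟨fun hw => ?_, fun hw => (List.takeWhile_sublist _).subset hw⟩
    rw [Set.mem_ofPred_eq]
    convert htake v w hvw hne hw
  exact sameType_iff_exists_isTreeIso (self_mem_prunedSubtree _ u) (hsub u) (hsub v)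

/-- The local conditions that characterize the sets of roots of the subtrees removed by complete
pruning sequences: at most `k` children of each type are kept, exactly `k` if one of that type
has been removed. -/
structure IsBalanced (G : SimpleGraph V) (p : V → Option V) (k : ℕ) (W : Set V) : Prop where
  root_notMem : ∀ w, p w = none → w ∉ W
  twinCount_le : ∀ u w, p w = some u → twinCount G p W u w ≤ k
  twinCount_eq : ∀ u w, p w = some u → w ∈ W → twinCount G p W u w = k

/-- Types at depth at least `d` do not see changes at depth at most `d`. -/
theorem IsForest.prunedSubtree_congr_depth (hp : IsForest p) {W W' : Set V} {d : ℕ}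
    (h : ∀ w, d < depth p w → (w ∈ W ↔ w ∈ W')) {v : V} (hv : d ≤ depth p v) :
    prunedSubtree p W v = prunedSubtree p W' v :=
  prunedSubtree_congr fun w hvw hne =>
    h w (hv.trans_lt ((hp.eq_or_depth_lt hvw).resolve_left (Ne.symm hne)))

theorem IsForest.twinCount_mono [Finite V] (hp : IsForest p) {W W' : Set V} {d : ℕ}
    (h : ∀ w, d < depth p w → (w ∈ W ↔ w ∈ W')) (hWW : W ⊆ W') {u w : V} (hw : p w = some u)
    (hd : d ≤ depth p w) : twinCount G p W' u w ≤ twinCount G p W u w := by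
  refine Set.ncard_le_ncard (fun x hx => ⟨hx.1, fun hW => hx.2.1 (hWW hW), ?_⟩) (Set.toFinite _)
  refine (SameTypeOff.congr ?_ ?_).2 hx.2.2
  · exact hp.prunedSubtree_congr_depth h hd
  · refine hp.prunedSubtree_congr_depth h ?_
    rwa [hp.depth_of_parent hx.1, ← hp.depth_of_parent hw]

theorem canPrune_of_lt_twinCount [Finite V] {k : ℕ} {ws : List V} {u w : V}
    (hu : u ∈ remaining p ws) (h : k < twinCount G p {x | x ∈ ws} u w) :
    ∃ x, p x = some u ∧ CanPrune G p k (remaining p ws) x := by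
  obtain ⟨x, hxu, hxW, hx⟩ : Set.Nonempty
      {x | p x = some u ∧ x ∉ {x | x ∈ ws} ∧ SameTypeOff G p {x | x ∈ ws} w x} :=
    Set.nonempty_of_ncard_ne_zero (Nat.ne_zero_of_lt h)
  exact ⟨x, hxu, canPrune_iff.2 ⟨(mem_remaining_iff_of_parent hxu hu).2 hxW, u, hxu,
    twinCount_congr hx ▸ h⟩⟩

/-- What holds throughout a pruning sequence: the depth of the valid prunings never increases, so
that the types of the siblings of a removed vertex do not change after its removal. -/
theorem IsPruningSequence.invariant [Finite V] (hp : IsForest p) {k : ℕ} {ws : List V}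
    (h : IsPruningSequence G p k ws) :
    (∀ w', CanPrune G p k (remaining p ws) w' → ∀ w ∈ ws, depth p w' ≤ depth p w) ∧
    (∀ w ∈ ws, ∃ u, p w = some u ∧ k ≤ twinCount G p {x | x ∈ ws} u w) ∧
    (∀ u w, p w = some u → u ∉ remaining p ws → twinCount G p {x | x ∈ ws} u w ≤ k) := by
  induction h with
  | nil => simp [remaining]
  | snoc ws w _ hw hmax ih =>
    obtain ⟨ihM, ihge, ihle⟩ := ih
    have hsub : {x | x ∈ ws} ⊆ {x | x ∈ ws ++ [w]} := fun x hx => List.mem_append_left _ hx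
    have hiff : ∀ x, depth p w < depth p x →
        (x ∈ {x | x ∈ ws} ↔ x ∈ {x | x ∈ ws ++ [w]}) := fun x hx => by
      have hne : x ≠ w := by rintro rfl; exact lt_irrefl _ hx
      simp [hne]
    have hrem : remaining p (ws ++ [w]) ⊆ remaining p ws := fun x hx w' hw' =>
      hx w' (List.mem_append_left _ hw')
    refine ⟨fun w' hw' => ?_, fun w₁ hw₁ => ?_, fun u w₁ hw₁ hu => ?_⟩
    · have hle : depth p w' ≤ depth p w := by
        by_contra hlt
        rw [not_le] at hlt
        obtain ⟨h1, u, hu, h2⟩ := canPrune_iff.1 hw'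
        have := hmax w' (canPrune_iff.2 ⟨hrem h1, u, hu,
          h2.trans_le (hp.twinCount_mono hiff hsub hu hlt.le)⟩)
        omega
      intro w₁ hw₁
      rcases List.mem_append.1 hw₁ with hw₁ | hw₁
      · exact hle.trans (ihM w hw w₁ hw₁)
      · rwa [List.mem_singleton.1 hw₁]
    · -- the removal of `w` lowers the count of `w₁` only if `w` is a twin of `w₁`, and then the
      -- count exceeded `k`
      have hd : depth p w ≤ depth p w₁ := by
        rcases List.mem_append.1 hw₁ with hw₁ | hw₁
        · exact ihM w hw w₁ hw₁
        · rw [List.mem_singleton.1 hw₁]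
      obtain ⟨hwrem, v, hv, hcount⟩ := canPrune_iff.1 hw
      obtain ⟨u, hu, hk⟩ : ∃ u, p w₁ = some u ∧ k ≤ twinCount G p {x | x ∈ ws} u w₁ := by
        rcases List.mem_append.1 hw₁ with hw₁ | hw₁
        · exact ihge w₁ hw₁
        · rw [List.mem_singleton.1 hw₁]
          exact ⟨v, hv, hcount.le⟩
      refine ⟨u, hu, ?_⟩
      have hT : ∀ x, p x = some u → (SameTypeOff G p {x | x ∈ ws ++ [w]} w₁ x ↔
          SameTypeOff G p {x | x ∈ ws} w₁ x) := fun x hx =>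
        SameTypeOff.congr (hp.prunedSubtree_congr_depth hiff hd).symm
          (hp.prunedSubtree_congr_depth hiff (by
            rwa [hp.depth_of_parent hx, ← hp.depth_of_parent hu])).symm
      have hset : {x | p x = some u ∧ x ∉ {x | x ∈ ws ++ [w]} ∧
          SameTypeOff G p {x | x ∈ ws ++ [w]} w₁ x} =
          {x | p x = some u ∧ x ∉ {x | x ∈ ws} ∧ SameTypeOff G p {x | x ∈ ws} w₁ x} \ {w} := by
        ext x
        constructor
        · rintro ⟨h1, h2, h3⟩
          exact ⟨⟨h1, fun h => h2 (hsub h), (hT x h1).1 h3⟩,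
            fun h => h2 (List.mem_append_right _ (List.mem_singleton.2 h))⟩
        · rintro ⟨⟨h1, h2, h3⟩, h4⟩
          refine ⟨h1, fun h => ?_, (hT x h1).2 h3⟩
          rcases List.mem_append.1 h with h | h
          · exact h2 h
          · exact h4 (List.mem_singleton.1 h)
      rw [twinCount, hset]
      by_cases hmem : w ∈ {x | p x = some u ∧ x ∉ {x | x ∈ ws} ∧
          SameTypeOff G p {x | x ∈ ws} w₁ x}
      · rw [Set.ncard_sdiff_singleton_of_mem hmem]
        obtain rfl : v = u := Option.some.inj (hv.symm.trans hmem.1)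
        have := twinCount_congr (u := v) hmem.2.2
        rw [← this] at hcount
        exact Nat.le_sub_one_of_lt hcount
      · rwa [Set.sdiff_singleton_eq_self hmem]
    · have hanc : ∃ w₂ ∈ ws ++ [w], IsAncestor p w₂ u := by
        by_contra hcon
        exact hu fun w₂ h₂ h₂' => hcon ⟨w₂, h₂, h₂'⟩
      obtain ⟨w₂, hw₂, hw₂u⟩ := hanc
      have hd : depth p w < depth p w₁ := by
        rw [hp.depth_of_parent hw₁, Nat.lt_succ_iff]
        refine le_trans ?_ (hp.depth_le_depth hw₂u)
        rcases List.mem_append.1 hw₂ with hw₂ | hw₂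
        · exact ihM w hw w₂ hw₂
        · rw [List.mem_singleton.1 hw₂]
      refine (hp.twinCount_mono hiff hsub hw₁ hd.le).trans ?_
      by_cases hu' : u ∈ remaining p ws
      · by_contra hlt
        obtain ⟨x, hx, hx'⟩ := canPrune_of_lt_twinCount hu' (not_le.1 hlt)
        have := hmax x hx'
        rw [hp.depth_of_parent hx, ← hp.depth_of_parent hw₁] at this
        omega
      · exact ihle u w₁ hw₁ hu'

/-- At most `k` children of each type are kept at a vertex: if it survives, by completeness of the
pruning sequence; otherwise, because deeper prunings had been exhausted when it was deleted. -/
theorem IsCompletePruning.isBalanced [Finite V] (hp : IsForest p) {k : ℕ} {ws : List V}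
    (h : IsCompletePruning G p k ws) : IsBalanced G p k {w | w ∈ ws} := by
  obtain ⟨hM, hge, hle⟩ := h.1.invariant hp
  have hle' : ∀ u w, p w = some u → twinCount G p {w | w ∈ ws} u w ≤ k := by
    intro u w hw
    by_cases hu : u ∈ remaining p ws
    · by_contra hlt
      obtain ⟨x, _, hx⟩ := canPrune_of_lt_twinCount hu (not_le.1 hlt)
      exact h.2 x hx
    · exact hle u w hw hu
  refine ⟨fun w hw hws => ?_, hle', fun u w hw hws => (hle' u w hw).antisymm ?_⟩
  · obtain ⟨u, hu, _⟩ := hge w hws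
    simp [hw] at hu
  · obtain ⟨u', hu', hk⟩ := hge w hws
    obtain rfl : u' = u := Option.some.inj (hu'.symm.trans hw)
    exact hk

/-- The vertices of a balanced set, taken by decreasing depth, form a complete pruning
sequence. -/
theorem IsBalanced.exists_isCompletePruning [Finite V] (hp : IsForest p) {k : ℕ} {W : Set V}
    (h : IsBalanced G p k W) :
    ∃ ws, IsCompletePruning G p k ws ∧ ∀ w, w ∈ ws ↔ w ∈ W := by
  classical
  -- the sets that contain, with any of their vertices, all deeper vertices of `W`, are the sets
  -- of the vertices of pruning sequences
  have main : ∀ Q : Finset V, (Q : Set V) ⊆ W →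
      (∀ x ∈ Q, ∀ y ∈ W, depth p x < depth p y → y ∈ Q) →
      ∃ ws, IsPruningSequence G p k ws ∧ ∀ w, w ∈ ws ↔ w ∈ Q := by
    intro Q
    induction Q using Finset.strongInduction with
    | H Q ih =>
      intro hQW hup
      rcases Q.eq_empty_or_nonempty with rfl | hQ
      · exact ⟨[], IsPruningSequence.nil, by simp⟩
      obtain ⟨w, hwQ, hmin⟩ := Q.exists_min_image (depth p) hQ
      obtain ⟨ws, hws, hmem⟩ := ih (Q.erase w) (Finset.erase_ssubset hwQ)
        (fun x hx => hQW (Finset.mem_of_mem_erase hx)) (fun x hx y hy hxy => by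
          refine Finset.mem_erase.2 ⟨?_, hup x (Finset.mem_of_mem_erase hx) y hy hxy⟩
          rintro rfl
          have := hmin x (Finset.mem_of_mem_erase hx)
          omega)
      have hsub : {x | x ∈ ws} ⊆ W := fun x hx =>
        hQW (Finset.mem_of_mem_erase ((hmem x).1 hx))
      have hiff : ∀ x, depth p w < depth p x → (x ∈ {x | x ∈ ws} ↔ x ∈ W) := fun x hx => by
        refine ⟨fun h => hsub h, fun h => (hmem x).2 (Finset.mem_erase.2
          ⟨?_, hup w hwQ x h hx⟩)⟩
        rintro rfl
        exact lt_irrefl _ hx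
      have hwws : w ∉ ws := fun h => by simpa using (hmem w).1 h
      refine ⟨ws ++ [w], IsPruningSequence.snoc ws w hws ?_ ?_, fun x => ?_⟩
      · cases hw : p w with
        | none => exact absurd (hQW hwQ) (h.root_notMem w hw)
        | some u =>
          refine canPrune_iff.2 ⟨fun w' hw' ha => ?_, u, hw, ?_⟩
          · have h1 := hmin w' (Finset.mem_of_mem_erase ((hmem w').1 hw'))
            rw [hp.eq_of_depth_le ha h1] at hw'
            exact hwws hw'
          · have hT : ∀ x, p x = some u → (SameTypeOff G p {x | x ∈ ws} w x ↔
                SameTypeOff G p W w x) := fun x hx =>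
              SameTypeOff.congr (hp.prunedSubtree_congr_depth hiff le_rfl)
                (hp.prunedSubtree_congr_depth hiff (by
                  rw [hp.depth_of_parent hx, ← hp.depth_of_parent hw]))
            rw [← h.twinCount_eq u w hw (hQW hwQ)]
            refine Set.ncard_lt_ncard ?_ (Set.toFinite _)
            rw [Set.ssubset_iff_of_subset]
            · exact ⟨w, ⟨hw, hwws, SameTypeOff.refl _ _⟩, fun hw' => hw'.2.1 (hQW hwQ)⟩
            · exact fun x hx => ⟨hx.1, fun h => hx.2.1 (hsub h), (hT x hx.1).2 hx.2.2⟩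
      · intro w' hw'
        by_contra hlt
        rw [not_le] at hlt
        obtain ⟨h1, u, hu, h2⟩ := canPrune_iff.1 hw'
        refine absurd (h.twinCount_le u w' hu) (not_le.2 (h2.trans_le ?_))
        have hT : ∀ x, p x = some u → depth p w < depth p x := fun x hx => by
          rwa [hp.depth_of_parent hx, ← hp.depth_of_parent hu]
        refine Set.ncard_le_ncard (fun x hx => ⟨hx.1, fun hW => hx.2.1 ?_, ?_⟩) (Set.toFinite _)
        · exact (hiff x (hT x hx.1)).2 hW
        · exact (SameTypeOff.congr (hp.prunedSubtree_congr_depth hiff hlt.le)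
            (hp.prunedSubtree_congr_depth hiff (hT x hx.1).le)).1 hx.2.2
      · rw [List.mem_append, hmem, Finset.mem_erase, List.mem_singleton]
        by_cases hx : x = w
        · simp [hx, hwQ]
        · simp [hx]
  obtain ⟨ws, hws, hmem⟩ := main W.toFinite.toFinset (by simp) (fun x _ y hy _ => by simpa using hy)
  have hW : {x | x ∈ ws} = W := by
    ext x
    simp [hmem]
  refine ⟨ws, ⟨hws, fun w hw => ?_⟩, fun w => by rw [← hW]; rfl⟩
  obtain ⟨_, u, hu, h2⟩ := canPrune_iff.1 hw
  rw [hW] at h2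
  exact absurd (h.twinCount_le u w hu) (not_le.2 h2)

end Pruning

/-! ### Boundedness of the codes of types -/

/-- The codes of the types of height less than `h`, with ancestor vectors of length at most `t` and
at most `k` children of each type at each vertex. -/
def boundedCodes (k t : ℕ) : ℕ → Set ℕ
  | 0 => ∅
  | h + 1 => {a | ∃ (b : List Bool) (m : Multiset ℕ), b.length ≤ t ∧
      (∀ τ ∈ m, τ ∈ boundedCodes k t h) ∧ (∀ τ, m.count τ ≤ k) ∧ a = Encodable.encode (b, m)}

theorem boundedCodes_finite (k t h : ℕ) : (boundedCodes k t h).Finite := by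
  classical
  induction h with
  | zero => exact Set.finite_empty
  | succ h ih =>
    have h1 : {b : List Bool | b.length ≤ t}.Finite := List.finite_length_le Bool t
    have h2 : {m : Multiset ℕ | m ≤ k • ih.toFinset.val}.Finite := Set.finite_Iic _
    refine ((h1.prod h2).image Encodable.encode).subset ?_
    rintro a ⟨b, m, hb, hm, hk, rfl⟩
    refine ⟨(b, m), ⟨hb, Multiset.le_iff_count.2 fun τ => ?_⟩, rfl⟩
    rw [Multiset.count_nsmul]
    by_cases hτ : τ ∈ m
    · rw [Multiset.count_eq_one_of_mem ih.toFinset.nodup (by simpa using hm τ hτ), mul_one]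
      exact hk τ
    · rw [Multiset.count_eq_zero_of_notMem hτ]
      exact Nat.zero_le _

theorem exists_bound_boundedCodes (k t : ℕ) :
    ∃ B, ∀ h ≤ t + 1, ∀ a ∈ boundedCodes k t h, a ≤ B := by
  have : (⋃ h ∈ Set.Iic (t + 1), boundedCodes k t h).Finite :=
    (Set.finite_Iic _).biUnion fun h _ => boundedCodes_finite k t h
  obtain ⟨B, hB⟩ := this.bddAbove
  exact ⟨B, fun h hh a ha => hB (Set.mem_biUnion (Set.mem_Iic.2 hh) ha)⟩

/-- A bound on the codes of the end types in trees of depth at most `t`. -/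
noncomputable def codeBound (k t : ℕ) : ℕ := (exists_bound_boundedCodes k t).choose

section Codes

variable {V : Type*} {G : SimpleGraph V} {p : V → Option V} {W : Set V}

theorem IsTypeCode.le_codeBound [Finite V] (hp : IsForest p) {L : V → ℕ}
    (hL : IsTypeCode G p W L) {k t : ℕ} (hW : IsBalanced G p k W) (ht : ∀ v, depth p v ≤ t)
    (v : V) : L v ≤ codeBound k t := by
  have main : ∀ n v, t + 1 - depth p v = n → L v ∈ boundedCodes k t n := by
    intro n
    induction n with
    | zero => intro v hv; have := ht v; omega
    | succ n ih =>
      intro v hv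
      obtain ⟨m, hm, hcount⟩ := hL v
      have hmem : ∀ τ ∈ m, ∃ w, p w = some v ∧ L w = τ := by
        intro τ hτ
        have h0 := Multiset.count_ne_zero.2 hτ
        rw [hcount] at h0
        obtain ⟨w, hw, _, hwτ⟩ := Set.nonempty_of_ncard_ne_zero h0
        exact ⟨w, hw, hwτ⟩
      refine ⟨vectorBits G p v, m, ?_, fun τ hτ => ?_, fun τ => ?_, hm⟩
      · simpa [vectorBits] using ht v
      · obtain ⟨w, hw, rfl⟩ := hmem τ hτ
        exact ih w (by rw [hp.depth_of_parent hw]; omega)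
      · by_cases hτ : τ ∈ m
        · obtain ⟨w, hw, rfl⟩ := hmem τ hτ
          refine le_trans (le_of_eq ?_) (hW.twinCount_le v w hw)
          rw [hcount, twinCount]
          simp only [← hL.eq_iff hp, eq_comm]
        · rw [Multiset.count_eq_zero_of_notMem hτ]
          exact Nat.zero_le _
  exact (exists_bound_boundedCodes k t).choose_spec _ (Nat.sub_le _ _) _ (main _ v rfl)

/-- The code of the type of `v`, computed from the vertices at distance less than `n` below `v`;
when the tree below `v` is higher, the value is meaningless. -/
noncomputable def truncatedCode [Finite V] (G : SimpleGraph V) (p : V → Option V) (W : Set V) :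
    ℕ → V → ℕ
  | 0, _ => 0
  | n + 1, v => Encodable.encode (vectorBits G p v,
      (Set.toFinite {w | p w = some v ∧ w ∉ W}).toFinset.val.map (truncatedCode G p W n))

theorem exists_isTypeCode [Finite V] (hp : IsForest p) {t : ℕ} (ht : ∀ v, depth p v ≤ t) :
    ∃ L, IsTypeCode G p W L := by
  classical
  refine ⟨fun v => truncatedCode G p W (t + 1 - depth p v) v, fun v => ?_⟩
  have h1 : t + 1 - depth p v = (t - depth p v) + 1 := by have := ht v; omega
  have h2 : ∀ w, p w = some v → t + 1 - depth p w = t - depth p v := fun w hw => by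
    rw [hp.depth_of_parent hw]; omega
  refine ⟨_, by beta_reduce; rw [h1]; rfl, fun τ => ?_⟩
  rw [Multiset.count_map, ← Finset.filter_val, Finset.card_val, ← Set.ncard_coe_finset]
  congr 1
  ext w
  simp only [Finset.coe_filter, Set.Finite.mem_toFinset, Set.mem_ofPred_eq]
  constructor
  · rintro ⟨⟨hw, hW⟩, h⟩
    exact ⟨hw, hW, by rw [h2 w hw, h]⟩
  · rintro ⟨hw, hW, h⟩
    exact ⟨⟨hw, hW⟩, by rw [← h, h2 w hw]⟩

/-! ### Connectivity of the subtrees of a coherent model -/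

/-- In a coherent model the vertices of every subtree induce a connected subgraph. -/
theorem IsCoherent.reachable [Finite V] (hp : IsForest p) (hc : IsCoherent G p) (a x : V)
    (hx : IsAncestor p a x) :
    (G.induce {x | IsAncestor p a x}).Reachable ⟨x, hx⟩ ⟨a, IsAncestor.refl a⟩ := by
  obtain ⟨N, hN⟩ : ∃ N, ∀ v, depth p v < N := by
    obtain ⟨N, hN⟩ := (Set.finite_range (depth p)).bddAbove
    exact ⟨N + 1, fun v => Nat.lt_succ_of_le (hN ⟨v, rfl⟩)⟩
  obtain ⟨n, hn⟩ : ∃ n, N ≤ depth p a + n := ⟨N, by omega⟩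
  induction n generalizing a x with
  | zero => exact absurd (hN a) (by omega)
  | succ n ih =>
    by_cases hxa : x = a
    · subst hxa
      rfl
    obtain ⟨b, hb, hbx⟩ := hp.exists_child hx hxa
    obtain ⟨y, hby, hya⟩ := hc a b hb
    have hle : {x | IsAncestor p b x} ≤ {x | IsAncestor p a x} :=
      fun z hz => (isAncestor_of_parent hb).trans hz
    have hbn : N ≤ depth p b + n := by rw [hp.depth_of_parent hb]; omega
    have h1 := (ih b x hbx hbn).trans (ih b y hby hbn).symm
    have h2 := h1.map (G.induceHomOfLE hle).toHom
    refine h2.trans (SimpleGraph.Adj.reachable ?_)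
    exact hya

/-- Every vertex of the subtree rooted at a child `a` of `u` can be led, inside this subtree and
along edges of `G` on which `D` decreases, to a neighbour of `u`. -/
theorem IsCoherent.exists_exitDistance [Fintype V] (hp : IsForest p) (hc : IsCoherent G p)
    {a u : V} (ha : p a = some u) :
    ∃ D : V → ℕ, (∀ v, D v ≤ Fintype.card V) ∧ ∀ v, IsAncestor p a v →
      G.Adj v u ∨ ∃ y, IsAncestor p a y ∧ G.Adj v y ∧ D y < D v := by
  classical
  obtain ⟨z, haz, hzu⟩ := hc u a ha
  have hreach : ∀ v (hv : IsAncestor p a v),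
      (G.induce {x | IsAncestor p a x}).Reachable ⟨v, hv⟩ ⟨z, haz⟩ := fun v hv =>
    (hc.reachable hp a v hv).trans (hc.reachable hp a z haz).symm
  refine ⟨fun v => if hv : IsAncestor p a v then
    (G.induce {x | IsAncestor p a x}).dist ⟨v, hv⟩ ⟨z, haz⟩ else 0, fun v => ?_, fun v hv => ?_⟩
  · by_cases hv : IsAncestor p a v
    · simp only [dif_pos hv]
      obtain ⟨q, hq, hq'⟩ := (hreach v hv).exists_path_of_dist
      rw [← hq']
      refine hq.length_lt.le.trans ?_
      exact Fintype.card_subtype_le _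
    · simp only [dif_neg hv]
      exact Nat.zero_le _
  · obtain ⟨q, hq⟩ := (hreach v hv).exists_walk_length_eq_dist
    cases q with
    | nil => exact Or.inl hzu
    | cons hadj q =>
      rename_i y
      refine Or.inr ⟨y.1, y.2, hadj, ?_⟩
      have hy : IsAncestor p a y.1 := y.2
      simp only [dif_pos hv, dif_pos hy]
      rw [← hq, SimpleGraph.Walk.length_cons]
      exact Nat.lt_succ_of_le (SimpleGraph.dist_le q)

end Codes

/-! ### Certificates as bit strings -/

/-- A self-delimiting encoding of lists of bits: a bit `true` announces a bit of the list, a bit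
`false` its end. -/
def encodeBits : List Bool → List Bool
  | [] => [false]
  | b :: l => true :: b :: encodeBits l

theorem encodeBits_append_inj {l l' x x' : List Bool}
    (h : encodeBits l ++ x = encodeBits l' ++ x') : l = l' ∧ x = x' := by
  induction l generalizing l' with
  | nil => cases l' <;> simp_all [encodeBits]
  | cons b l ih =>
    cases l' with
    | nil => simp [encodeBits] at h
    | cons b' l' =>
      simp only [encodeBits, List.cons_append, List.cons.injEq, true_and] at h
      obtain ⟨rfl, h⟩ := h
      obtain ⟨rfl, rfl⟩ := ih h
      exact ⟨rfl, rfl⟩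

theorem length_encodeBits (l : List Bool) : (encodeBits l).length = 2 * l.length + 1 := by
  induction l with
  | nil => rfl
  | cons b l ih => simp only [encodeBits, List.length_cons, ih]; omega

/-- What a certificate holds about an ancestor: the record read off by the decoder and a distance
to the exit of the subtree rooted at this ancestor. -/
abbrev Entry := AncestorRecord × ℕ

/-- A self-delimiting encoding of the four components of an entry, numbers being in binary. -/
def encodeEntry (e : Entry) : List Bool :=
  encodeBits e.1.id.bits ++ (encodeBits e.1.endType.bits ++
    (encodeBits e.2.bits ++ [e.1.pruned]))

theorem bits_injective : Function.Injective Nat.bits := by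
  refine Function.LeftInverse.injective (g := List.foldr Nat.bit 0) fun n => ?_
  induction n using Nat.binaryRec' with
  | zero => simp
  | bit b n h ih => rw [Nat.bits_append_bit n b h, List.foldr_cons, ih]

theorem encodeEntry_append_inj {e e' : Entry} {x x' : List Bool}
    (h : encodeEntry e ++ x = encodeEntry e' ++ x') : e = e' ∧ x = x' := by
  obtain ⟨⟨i, b, τ⟩, d⟩ := e
  obtain ⟨⟨i', b', τ'⟩, d'⟩ := e'
  simp only [encodeEntry, List.append_assoc] at h
  obtain ⟨h1, h⟩ := encodeBits_append_inj h
  obtain ⟨h2, h⟩ := encodeBits_append_inj h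
  obtain ⟨h3, h⟩ := encodeBits_append_inj h
  simp only [List.cons_append, List.nil_append, List.cons.injEq] at h
  simp [bits_injective h1, bits_injective h2, bits_injective h3, h]

/-- The certificate made of a list of entries. -/
def encodeEntries (E : List Entry) : List Bool := E.flatMap encodeEntry

theorem encodeEntry_ne_nil (e : Entry) : encodeEntry e ≠ [] := by
  simp [encodeEntry]

theorem encodeEntries_injective : Function.Injective encodeEntries := by
  intro E
  induction E with
  | nil =>
    intro E' h
    cases E' with
    | nil => rfl
    | cons e E' => simp [encodeEntries, encodeEntry_ne_nil] at h
  | cons e E ih =>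
    intro E' h
    cases E' with
    | nil => simp [encodeEntries, encodeEntry_ne_nil] at h
    | cons e' E' =>
      simp only [encodeEntries, List.flatMap_cons] at h
      obtain ⟨he, hE⟩ := encodeEntry_append_inj h
      rw [he, ih hE]

/-- Some left inverse of `encodeEntries`; nothing is needed about its values outside the range of
`encodeEntries`. -/
noncomputable def decodeEntries : List Bool → List Entry := Function.invFun encodeEntries

theorem decodeEntries_encodeEntries (E : List Entry) : decodeEntries (encodeEntries E) = E :=
  Function.leftInverse_invFun encodeEntries_injective E

theorem size_le_two_mul_log {m : ℕ} (hm : 1 ≤ m) : (m.size : ℝ) ≤ 2 * Real.log m + 1 := by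
  obtain ⟨s, hs⟩ : ∃ s, m.size = s + 1 :=
    Nat.exists_eq_succ_of_ne_zero (Nat.size_pos.2 hm).ne'
  have h1 : 2 ^ s ≤ m := Nat.lt_size.1 (by omega)
  have h2 : (s : ℝ) * Real.log 2 ≤ Real.log m := by
    rw [← Real.log_pow]
    exact Real.log_le_log (by positivity) (by exact_mod_cast h1)
  have h3 : (1 / 2 : ℝ) ≤ Real.log 2 := by linarith [Real.log_two_gt_d9]
  have h4 : (s : ℝ) * (1 / 2) ≤ s * Real.log 2 := by gcongr
  rw [hs]
  push_cast
  linarith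

theorem length_encodeEntry_le {e : Entry} {n c B : ℕ} (hn : 1 ≤ n) (hid : e.1.id ≤ n ^ c)
    (hB : e.1.endType ≤ B) (hd : e.2 ≤ n) :
    ((encodeEntry e).length : ℝ) ≤ 4 * (c + 1) * Real.log n + (2 * B + 8) := by
  have h1 : (e.1.id.size : ℝ) ≤ 2 * (c * Real.log n) + 1 := by
    refine le_trans (Nat.cast_le.2 (Nat.size_le_size hid)) ?_
    simpa using size_le_two_mul_log (Nat.one_le_pow c n hn)
  have h2 : (e.1.endType.size : ℝ) ≤ B :=
    Nat.cast_le.2 (Nat.size_le.2 (hB.trans_lt Nat.lt_two_pow_self))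
  have h3 : (e.2.size : ℝ) ≤ 2 * Real.log n + 1 :=
    le_trans (Nat.cast_le.2 (Nat.size_le_size hd)) (size_le_two_mul_log hn)
  have h4 : (encodeEntry e).length =
      2 * e.1.id.size + 1 + (2 * e.1.endType.size + 1 + (2 * e.2.size + 1 + 1)) := by
    simp [encodeEntry, length_encodeBits, Nat.size_eq_bits_len]
  rw [h4]
  push_cast
  linarith

theorem length_encodeEntries_le {E : List Entry} {n c B t : ℕ} (hn : 1 ≤ n)
    (hlen : E.length ≤ t + 1) (ht : t = 0 → n = 1)
    (hE : ∀ e ∈ E, e.1.id ≤ n ^ c ∧ e.1.endType ≤ B ∧ e.2 ≤ n) :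
    ((encodeEntries E).length : ℝ) ≤
      (8 * (c + 1) : ℕ) * (t * Real.log n + ((t + 1) * (2 * B + 8) : ℕ)) := by
  have hlog : 0 ≤ Real.log n := Real.log_natCast_nonneg n
  have h1 : ((encodeEntries E).length : ℝ) ≤
      E.length * (4 * (c + 1) * Real.log n + (2 * B + 8)) := by
    clear hlen
    induction E with
    | nil => simp [encodeEntries]
    | cons e E ih =>
      have h := hE e List.mem_cons_self
      have h' := length_encodeEntry_le hn h.1 h.2.1 h.2.2
      have ih := ih fun e he => hE e (List.mem_cons_of_mem _ he)
      simp only [encodeEntries, List.flatMap_cons, List.length_append, List.length_cons] at ih ⊢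
      push_cast
      linarith
  have h2 : (E.length : ℝ) ≤ t + 1 := by exact_mod_cast hlen
  -- for `t = 0` the graph has a single vertex, and the logarithm vanishes
  have h3 : Real.log n ≤ t * Real.log n := by
    rcases Nat.eq_zero_or_pos t with h | h
    · simp [ht h]
    · have : (1 : ℝ) ≤ t := by exact_mod_cast h
      nlinarith
  have h4 : E.length * (4 * (c + 1) * Real.log n + (2 * B + 8)) ≤
      ((t : ℝ) + 1) * (4 * (c + 1) * Real.log n + (2 * B + 8)) :=
    mul_le_mul_of_nonneg_right h2 (by positivity)
  have h5 : 4 * ((c : ℝ) + 1) * Real.log n ≤ 4 * (c + 1) * (t * Real.log n) :=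
    mul_le_mul_of_nonneg_left h3 (by positivity)
  -- the constant factor is only needed on the logarithm
  have h6 : (0 : ℝ) ≤ (8 * c + 7) * ((t + 1) * (2 * B + 8)) := by positivity
  push_cast
  nlinarith

/-! ### The verifier -/

/-- The decoder: it forgets the distances. -/
noncomputable def decodeRecords (l : List Bool) : List AncestorRecord :=
  (decodeEntries l).map Prod.fst

/-- The entries on the ancestors of the vertex, from itself to the root, in its certificate. -/
noncomputable def NodeInfo.entries (I : NodeInfo) : List Entry := decodeEntries I.cert

/-- The records of the ancestors of the vertex, from itself to the root, in its certificate. -/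
noncomputable def NodeInfo.records (I : NodeInfo) : List AncestorRecord := decodeRecords I.cert

theorem NodeInfo.map_entries (I : NodeInfo) : I.entries.map Prod.fst = I.records := rfl

/-- The part of the verification that concerns the tree. The condition `exit` states that, for
each proper subtree containing the vertex, the vertex either sees the parent of the root of this
subtree, or has a neighbour in the same subtree at a smaller distance to the exit. -/
structure TreeCheck (t : ℕ) (I : NodeInfo) (N : Set NodeInfo) : Prop where
  records_eq_cons : ∃ r l, I.records = r :: l ∧ r.id = I.id ∧
    I.parentId = l.head?.map AncestorRecord.id
  length_le : I.records.length ≤ t + 1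
  comparable : ∀ J ∈ N, J.records <:+ I.records ∨ I.records <:+ J.records
  exit : ∀ e l, (e :: l) <:+ I.entries → l ≠ [] →
    (∃ J ∈ N, J.records = l.map Prod.fst) ∨
    ∃ J ∈ N, ∃ f l', (f :: l') <:+ J.entries ∧ f.1 = e.1 ∧ l'.map Prod.fst = l.map Prod.fst ∧
      f.2 < e.2

/-- The records of the children of a vertex: in a coherent model every child has a descendant
among the neighbours of the vertex, so that the vertex sees the records of all its children. -/
def childRecords (I : NodeInfo) (N : Set NodeInfo) : Set AncestorRecord :=
  {s | ∃ J ∈ N, (s :: I.records) <:+ J.records}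

/-- The number of children not pruned whose recorded end type is `τ`, as seen by the vertex. -/
noncomputable def keptCount (I : NodeInfo) (N : Set NodeInfo) (τ : ℕ) : ℕ :=
  Set.ncard {s | s ∈ childRecords I N ∧ s.pruned = false ∧ s.endType = τ}

open Classical in
/-- The ancestor vector, as seen by the vertex. -/
noncomputable def seenVector (I : NodeInfo) (N : Set NodeInfo) : List Bool :=
  (List.range (I.records.length - 1)).map fun j =>
    decide (∃ J ∈ N, J.records <:+ I.records ∧ J.records.length = j + 1)

/-- The part of the verification that concerns the pruning: the end type of a vertex is computed
from those of its children that are not pruned, and the children satisfy the counting conditions of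
`IsBalanced`. -/
structure PruningCheck (k : ℕ) (I : NodeInfo) (N : Set NodeInfo) : Prop where
  inH_iff : I.inH ↔ ∀ r ∈ I.records, r.pruned = false
  root : ∀ r, I.records = [r] → r.pruned = false
  endType : ∀ r l, I.records = r :: l → ∃ m : Multiset ℕ,
    r.endType = Encodable.encode (seenVector I N, m) ∧ ∀ τ, m.count τ = keptCount I N τ
  keptCount_le : ∀ s ∈ childRecords I N, keptCount I N s.endType ≤ k
  keptCount_eq : ∀ s ∈ childRecords I N, s.pruned = true → keptCount I N s.endType = k

section Verification

variable {V : Type*} {G : SimpleGraph V} {ids : V → ℕ} {p : V → Option V} {H : Set V}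
  {cert : V → List Bool} {ρ : V → AncestorRecord}

theorem map_record_injective (hids : Function.Injective ids) (hρ : ∀ v, (ρ v).id = ids v) :
    Function.Injective (List.map ρ) :=
  List.map_injective_iff.2 fun a b h => hids (by rw [← hρ, ← hρ, h])

theorem suffix_map_record_iff (hp : IsForest p) (hids : Function.Injective ids)
    (hρ : ∀ v, (ρ v).id = ids v) {a v : V} :
    (ancestorList p a).map ρ <:+ (ancestorList p v).map ρ ↔ IsAncestor p a v := by
  rw [List.suffix_map_iff_of_injective (fun a b h => hids (by rw [← hρ, ← hρ, h])),
    hp.ancestorList_suffix_iff]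

theorem childRecords_eq (hp : IsForest p) (hc : IsCoherent G p) (hids : Function.Injective ids)
    (hρ : ∀ v, (ρ v).id = ids v)
    (hR : ∀ v, (nodeInfo ids p H cert v).records = (ancestorList p v).map ρ) (v : V) :
    childRecords (nodeInfo ids p H cert v) (nodeInfo ids p H cert '' G.neighborSet v) =
      ρ '' {w | p w = some v} := by
  ext s
  constructor
  · rintro ⟨_, ⟨y, hy, rfl⟩, hs⟩
    rw [hR, hR, List.suffix_map_iff] at hs
    obtain ⟨l, hl, hsl⟩ := hs
    obtain ⟨a, ha, rfl⟩ := hp.suffix_ancestorList hl (by rintro rfl; simp at hsl)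
    cases hpa : p a with
    | none =>
      obtain ⟨l', hl'⟩ := hp.ancestorList_eq_cons v
      simp [ancestorList_of_root hpa, hl'] at hsl
    | some u =>
      rw [hp.ancestorList_of_parent hpa, List.map_cons, List.cons.injEq] at hsl
      have huv := hp.ancestorList_injective (map_record_injective hids hρ hsl.2)
      exact ⟨a, by rw [huv]; exact hpa, hsl.1.symm⟩
  · rintro ⟨w, hw, rfl⟩
    obtain ⟨x, hwx, hxv⟩ := hc v w hw
    refine ⟨_, ⟨x, hxv.symm, rfl⟩, ?_⟩
    rw [hR, hR, ← List.map_cons, ← hp.ancestorList_of_parent hw,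
      suffix_map_record_iff hp hids hρ]
    exact hwx

theorem keptCount_eq (hp : IsForest p) (hc : IsCoherent G p) (hids : Function.Injective ids)
    (hρ : ∀ v, (ρ v).id = ids v)
    (hR : ∀ v, (nodeInfo ids p H cert v).records = (ancestorList p v).map ρ) (v : V) (τ : ℕ) :
    keptCount (nodeInfo ids p H cert v) (nodeInfo ids p H cert '' G.neighborSet v) τ =
      Set.ncard {w | p w = some v ∧ w ∉ {a | (ρ a).pruned = true} ∧ (ρ w).endType = τ} := by
  have hinj : Function.Injective ρ := fun a b h => hids (by rw [← hρ, ← hρ, h])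
  rw [keptCount, childRecords_eq hp hc hids hρ hR, ← Set.ncard_image_of_injective _ hinj]
  congr 1
  ext s
  constructor
  · rintro ⟨⟨w, hw, rfl⟩, h1, h2⟩
    exact ⟨w, ⟨hw, by simp [h1], h2⟩, rfl⟩
  · rintro ⟨w, ⟨hw, h1, h2⟩, rfl⟩
    exact ⟨⟨w, hw, rfl⟩, by simpa using h1, h2⟩

theorem seenVector_eq (hp : IsForest p) (hids : Function.Injective ids)
    (hρ : ∀ v, (ρ v).id = ids v)
    (hR : ∀ v, (nodeInfo ids p H cert v).records = (ancestorList p v).map ρ) (v : V) :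
    seenVector (nodeInfo ids p H cert v) (nodeInfo ids p H cert '' G.neighborSet v) =
      vectorBits G p v := by
  rw [seenVector, vectorBits, hR, List.length_map, hp.length_ancestorList, Nat.add_sub_cancel]
  refine List.map_congr_left fun j _ => ?_
  rw [decide_eq_decide, Set.exists_mem_image]
  refine exists_congr fun a => ?_
  rw [hR, suffix_map_record_iff hp hids hρ, List.length_map, hp.length_ancestorList,
    Nat.add_right_cancel_iff, SimpleGraph.mem_neighborSet]
  tauto

/-- If the certificates list, for every vertex, the records `ρ` of its ancestors, then the pruning
checks express that the recorded end types code the types after the removal of the pruned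
vertices, that the set of pruned vertices is balanced, and that `H` is what remains. -/
theorem forall_pruningCheck_iff [Finite V] (hp : IsForest p) (hc : IsCoherent G p)
    (hids : Function.Injective ids) (hρ : ∀ v, (ρ v).id = ids v)
    (hR : ∀ v, (nodeInfo ids p H cert v).records = (ancestorList p v).map ρ) (k : ℕ) :
    (∀ v, PruningCheck k (nodeInfo ids p H cert v) (nodeInfo ids p H cert '' G.neighborSet v)) ↔
      (∀ v, v ∈ H ↔ ∀ a, IsAncestor p a v → a ∉ {a | (ρ a).pruned = true}) ∧
      IsTypeCode G p {a | (ρ a).pruned = true} (fun v => (ρ v).endType) ∧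
      IsBalanced G p k {a | (ρ a).pruned = true} := by
  have hkept := keptCount_eq hp hc hids hρ hR
  have hvec := seenVector_eq (G := G) hp hids hρ hR
  have hchild := childRecords_eq hp hc hids hρ hR
  have htwin : IsTypeCode G p {a | (ρ a).pruned = true} (fun v => (ρ v).endType) →
      ∀ u w, twinCount G p {a | (ρ a).pruned = true} u w =
        Set.ncard {x | p x = some u ∧ x ∉ {a | (ρ a).pruned = true} ∧
          (ρ x).endType = (ρ w).endType} := by
    intro hL u w
    rw [twinCount]
    congr 1
    ext x
    have := hL.eq_iff hp x w
    exact and_congr_right fun _ => and_congr_right fun _ =>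
      ⟨fun h => this.2 h.symm, fun h => (this.1 h).symm⟩
  have hinH : ∀ v, (∀ r ∈ (nodeInfo ids p H cert v).records, r.pruned = false) ↔
      ∀ a, IsAncestor p a v → a ∉ {a | (ρ a).pruned = true} := fun v => by
    rw [hR]
    simp [hp.mem_ancestorList]
  constructor
  · intro h
    have hL : IsTypeCode G p {a | (ρ a).pruned = true} (fun v => (ρ v).endType) := by
      intro v
      obtain ⟨l, hl⟩ := hp.ancestorList_eq_cons v
      obtain ⟨m, hm, hcount⟩ := (h v).endType (ρ v) (l.map ρ) (by rw [hR, hl]; rfl)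
      exact ⟨m, by rw [← hvec]; exact hm, fun τ => by rw [hcount, hkept]⟩
    refine ⟨fun v => (h v).inH_iff.trans (hinH v), hL, fun w hw => ?_, fun u w hw => ?_,
      fun u w hw hW => ?_⟩
    · have := (h w).root (ρ w) (by rw [hR, ancestorList_of_root hw]; rfl)
      simp [this]
    · rw [htwin hL, ← hkept]
      exact (h u).keptCount_le (ρ w) (by rw [hchild]; exact ⟨w, hw, rfl⟩)
    · rw [htwin hL, ← hkept]
      exact (h u).keptCount_eq (ρ w) (by rw [hchild]; exact ⟨w, hw, rfl⟩) hW
  · rintro ⟨hH, hL, hW⟩ v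
    refine ⟨(hH v).trans (hinH v).symm, fun r hr => ?_, fun r l hr => ?_, fun s hs => ?_,
      fun s hs hpr => ?_⟩
    · rw [hR] at hr
      cases hv : p v with
      | none =>
        rw [ancestorList_of_root hv] at hr
        obtain rfl : ρ v = r := by simpa using hr
        simpa using hW.root_notMem v hv
      | some u =>
        obtain ⟨l, hl⟩ := hp.ancestorList_eq_cons u
        simp [hp.ancestorList_of_parent hv, hl] at hr
    · obtain ⟨l', hl'⟩ := hp.ancestorList_eq_cons v
      rw [hR, hl', List.map_cons, List.cons.injEq] at hr
      obtain ⟨m, hm, hcount⟩ := hL v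
      exact ⟨m, by rw [hvec, ← hm, ← hr.1], fun τ => by rw [hcount, hkept]⟩
    · rw [hchild] at hs
      obtain ⟨w, hw, rfl⟩ := hs
      rw [hkept, ← htwin hL]
      exact hW.twinCount_le v w hw
    · rw [hchild] at hs
      obtain ⟨w, hw, rfl⟩ := hs
      rw [hkept, ← htwin hL]
      exact hW.twinCount_eq v w hw hpr

theorem records_of_map {ws : List V} {L : V → ℕ}
    (hL : ∀ a b, L a = L b ↔ SameEndType G p ws a b) (hρ : ∀ v, (ρ v).id = ids v)
    (hpr : ∀ v, (ρ v).pruned = true ↔ v ∈ ws) (hρL : ∀ v, (ρ v).endType = L v)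
    (hR : ∀ v, decodeRecords (cert v) = (ancestorList p v).map ρ) :
    Records decodeRecords G ids p ws cert := by
  refine ⟨L, hL, fun v => ?_⟩
  rw [hR, List.forall₂_map_right_iff, List.forall₂_same]
  exact fun a _ => ⟨hρ a, hpr a, hρL a⟩

/-! ### Soundness -/

/-- Following decreasing distances leads to the exit of the subtree. -/
theorem exists_exit_of_treeCheck {t : ℕ}
    (h : ∀ v, TreeCheck t (nodeInfo ids p H cert v) (nodeInfo ids p H cert '' G.neighborSet v))
    (y : V) (e : Entry) (l : List Entry) (hsuf : (e :: l) <:+ (nodeInfo ids p H cert y).entries)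
    (hl : l ≠ []) :
    ∃ x z, G.Adj x z ∧ (nodeInfo ids p H cert z).records = l.map Prod.fst ∧
      (e.1 :: l.map Prod.fst) <:+ (nodeInfo ids p H cert x).records := by
  obtain ⟨n, hn⟩ : ∃ n, e.2 = n := ⟨_, rfl⟩
  induction n using Nat.strong_induction_on generalizing y e l with
  | _ n ih =>
    rcases (h y).exit e l hsuf hl with
      ⟨_, ⟨z, hz, rfl⟩, hzl⟩ | ⟨_, ⟨z, hz, rfl⟩, f, l', hf, h1, h2, h3⟩
    · exact ⟨y, z, hz, hzl, hsuf.map Prod.fst⟩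
    · have hl' : l' ≠ [] := by
        rintro rfl
        exact hl (List.map_eq_nil_iff.1 h2.symm)
      obtain ⟨x, z', hx⟩ := ih f.2 (hn ▸ h3) z f l' hf hl' rfl
      rw [h1, h2] at hx
      exact ⟨x, z', hx⟩

/-- If all the tree checks succeed, then the tree is a coherent model and the certificates list
the records of the ancestors. -/
theorem isModel_of_treeCheck (hG : G.Connected) (hids : Function.Injective ids) {t : ℕ}
    (h : ∀ v, TreeCheck t (nodeInfo ids p H cert v) (nodeInfo ids p H cert '' G.neighborSet v)) :
    IsModel G p t ∧ IsCoherent G p ∧ ∃ ρ : V → AncestorRecord, (∀ v, (ρ v).id = ids v) ∧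
      ∀ v, (nodeInfo ids p H cert v).records = (ancestorList p v).map ρ := by
  choose ρ l hρl hρ hparent using fun v => (h v).records_eq_cons
  replace hρ : ∀ v, (ρ v).id = ids v := hρ
  replace hparent : ∀ v, (p v).map ids = (l v).head?.map AncestorRecord.id := hparent
  have hroot : ∀ v, p v = none → l v = [] := fun v hv => by
    have := hparent v
    rw [hv] at this
    simpa using this.symm
  have hentries : ∀ v u, p v = some u → ∃ e l', (nodeInfo ids p H cert v).entries = e :: l' ∧
      l' ≠ [] ∧ e.1 = ρ v ∧ l'.map Prod.fst = l v := fun v u hv => by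
    have h1 := hρl v
    rw [← NodeInfo.map_entries, List.map_eq_cons_iff] at h1
    obtain ⟨e, l', h2, h3, h4⟩ := h1
    refine ⟨e, l', h2, ?_, h3, h4⟩
    rintro rfl
    have := hparent v
    rw [hv, ← h4] at this
    simp at this
  have hexit : ∀ v u, p v = some u → ∃ x, G.Adj x u ∧
      (nodeInfo ids p H cert u).records = l v ∧
      (nodeInfo ids p H cert v).records <:+ (nodeInfo ids p H cert x).records := by
    intro v u hv
    obtain ⟨e, l', h1, h2, h3, h4⟩ := hentries v u hv
    obtain ⟨x, z, hxz, hz, hx⟩ := exists_exit_of_treeCheck h v e l' (by rw [h1]) h2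
    have hzu : z = u := by
      have := hparent v
      rw [hv, ← h4, ← hz, hρl z] at this
      simp only [Option.map_some, List.head?_cons, Option.some.injEq] at this
      exact hids (by rw [← hρ z, ← this])
    subst hzu
    refine ⟨x, hxz, by rw [hz, h4], ?_⟩
    rw [hρl v, ← h3, ← h4]
    exact hx
  have hup : ∀ n v, (l v).length = n → up p v (n + 1) = none := by
    intro n
    induction n with
    | zero =>
      intro v hv
      cases hpv : p v with
      | none => exact up_succ_of_root hpv 0
      | some u =>
        obtain ⟨_, _, h1, _⟩ := hexit v u hpv
        rw [hρl u, List.length_eq_zero_iff.1 hv] at h1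
        cases h1
    | succ n ih =>
      intro v hv
      cases hpv : p v with
      | none => exact up_succ_of_root hpv _
      | some u =>
        obtain ⟨_, _, h1, _⟩ := hexit v u hpv
        rw [up_succ_of_parent hpv]
        refine ih u ?_
        rw [← h1, hρl u, List.length_cons] at hv
        omega
  have hp : IsForest p := fun v => ⟨_, hup _ v rfl⟩
  have hR : ∀ v, (nodeInfo ids p H cert v).records = (ancestorList p v).map ρ := by
    intro v
    induction v using hp.induction with
    | root v hv => rw [hρl, hroot v hv, ancestorList_of_root hv]; rfl
    | child v u hv ih =>
      obtain ⟨_, _, h1, _⟩ := hexit v u hv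
      rw [hρl, ← h1, ih, hp.ancestorList_of_parent hv]
      rfl
  have hadj : ∀ u v, G.Adj u v → IsAncestor p u v ∨ IsAncestor p v u := fun u v huv => by
    have := (h v).comparable _ ⟨u, huv.symm, rfl⟩
    rwa [hR, hR, suffix_map_record_iff hp hids hρ, suffix_map_record_iff hp hids hρ] at this
  refine ⟨⟨?_, fun v => ⟨(l v).length, ?_, hup _ v rfl⟩, hadj⟩, fun v w hw => ?_, ρ, hρ, hR⟩
  · obtain ⟨v⟩ := hG.nonempty
    obtain ⟨r, hr⟩ : ∃ r, p r = none := by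
      induction v using hp.induction with
      | root v hv => exact ⟨v, hv⟩
      | child v u _ ih => exact ih
    refine ⟨r, hr, fun r' hr' => ?_⟩
    -- being a descendant of `r` is preserved along the edges of `G`
    have key : ∀ v, G.Walk r v → IsAncestor p r v := by
      have : ∀ u v, G.Walk u v → IsAncestor p r u → IsAncestor p r v := by
        intro u v q
        induction q with
        | nil => exact id
        | cons huv _ ih =>
          intro hru
          refine ih ?_
          rcases hadj _ _ huv with h' | h'
          · exact hru.trans h'
          · rcases hru.total h' with h'' | h''
            · exact h''
            · rw [(isAncestor_iff_of_root hr).1 h'']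
              exact IsAncestor.refl r
      exact fun v q => this r v q (IsAncestor.refl r)
    obtain ⟨q⟩ := hG.preconnected r r'
    exact ((isAncestor_iff_of_root hr').1 (key r' q)).symm
  · have := (h v).length_le
    rw [hρl v, List.length_cons] at this
    omega
  · obtain ⟨x, hx, _, h2⟩ := hexit w v hw
    rw [hR, hR, suffix_map_record_iff hp hids hρ] at h2
    exact ⟨x, h2, hx⟩

theorem exists_records_of_checks [Finite V] (hG : G.Connected) (hids : Function.Injective ids)
    {k t : ℕ}
    (h : ∀ v, TreeCheck t (nodeInfo ids p H cert v) (nodeInfo ids p H cert '' G.neighborSet v))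
    (h' : ∀ v,
      PruningCheck k (nodeInfo ids p H cert v) (nodeInfo ids p H cert '' G.neighborSet v)) :
    IsModel G p t ∧ IsCoherent G p ∧ ∃ ws, IsCompletePruning G p k ws ∧ H = remaining p ws ∧
      Records decodeRecords G ids p ws cert := by
  obtain ⟨hM, hc, ρ, hρ, hR⟩ := isModel_of_treeCheck hG hids h
  have hp := hM.isForest
  obtain ⟨hH, hL, hW⟩ := (forall_pruningCheck_iff hp hc hids hρ hR k).1 h'
  obtain ⟨ws, hws, hmem⟩ := hW.exists_isCompletePruning hp
  have hset : {w | w ∈ ws} = {a | (ρ a).pruned = true} := Set.ext hmem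
  refine ⟨hM, hc, ws, hws, ?_, ?_⟩
  · ext v
    rw [hH v]
    exact ⟨fun h w hw ha => h w ha ((hmem w).1 hw), fun h a ha hW => h a ((hmem a).2 hW) ha⟩
  · refine records_of_map (L := fun v => (ρ v).endType) (fun a b => ?_) hρ
      (fun v => (hmem v).symm) (fun _ => rfl) hR
    rw [hws.1.sameEndType_iff hp, hset]
    exact hL.eq_iff hp a b

/-! ### Completeness -/

/-- For every complete pruning sequence there are short certificates that record its data and that
all the vertices accept. -/
theorem exists_cert_of_isCompletePruning [Fintype V] (hids : Function.Injective ids) {c k t : ℕ}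
    (hle : ∀ v, ids v ≤ Fintype.card V ^ c) (hM : IsModel G p t) (hc : IsCoherent G p)
    {ws : List V} (hws : IsCompletePruning G p k ws) (hH : H = remaining p ws) :
    ∃ cert : V → List Bool,
      (∀ v, ((cert v).length : ℝ) ≤ (8 * (c + 1) : ℕ) *
        (t * Real.log (Fintype.card V) + ((t + 1) * (2 * codeBound k t + 8) : ℕ))) ∧
      Records decodeRecords G ids p ws cert ∧
      ∀ v, TreeCheck t (nodeInfo ids p H cert v) (nodeInfo ids p H cert '' G.neighborSet v) ∧
        PruningCheck k (nodeInfo ids p H cert v) (nodeInfo ids p H cert '' G.neighborSet v) := by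
  classical
  have hp := hM.isForest
  obtain ⟨L, hL⟩ := exists_isTypeCode (G := G) (W := {w | w ∈ ws}) hp hM.depth_le'
  have hW := hws.isBalanced hp
  have hD : ∀ a, ∃ D : V → ℕ, (∀ v, D v ≤ Fintype.card V) ∧ ∀ u, p a = some u → ∀ v,
      IsAncestor p a v → G.Adj v u ∨ ∃ y, IsAncestor p a y ∧ G.Adj v y ∧ D y < D v := by
    intro a
    cases ha : p a with
    | none => exact ⟨fun _ => 0, by simp, by simp⟩
    | some u =>
      obtain ⟨D, h1, h2⟩ := hc.exists_exitDistance hp ha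
      refine ⟨D, h1, fun u' hu' => ?_⟩
      obtain rfl := Option.some.inj hu'
      exact h2
  choose D hD1 hD2 using hD
  let ρ : V → AncestorRecord := fun a => ⟨ids a, decide (a ∈ ws), L a⟩
  let entry : V → V → Entry := fun v a => (ρ a, D a v)
  let cert : V → List Bool := fun v => encodeEntries ((ancestorList p v).map (entry v))
  have hρ : ∀ v, (ρ v).id = ids v := fun _ => rfl
  have hE : ∀ v, (nodeInfo ids p H cert v).entries = (ancestorList p v).map (entry v) :=
    fun v => decodeEntries_encodeEntries _
  have hfst : ∀ v l, List.map Prod.fst (List.map (entry v) l) = l.map ρ := fun v l => by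
    rw [List.map_map]
    rfl
  have hR : ∀ v, (nodeInfo ids p H cert v).records = (ancestorList p v).map ρ := fun v => by
    rw [← NodeInfo.map_entries, hE, hfst]
  have hset : {a | (ρ a).pruned = true} = {w | w ∈ ws} := by
    ext a
    simp [ρ]
  have hprune := (forall_pruningCheck_iff hp hc hids hρ hR k).2 (by
    rw [hset]
    refine ⟨fun v => ?_, hL, hW⟩
    rw [hH]
    exact ⟨fun h a ha hw => h a hw ha, fun h w hw ha => h w ha hw⟩)
  refine ⟨cert, fun v => ?_, ?_, fun v => ⟨⟨?_, ?_, ?_, ?_⟩, hprune v⟩⟩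
  · refine length_encodeEntries_le (Fintype.card_pos_iff.2 ⟨v⟩) ?_ ?_ ?_
    · rw [List.length_map, hp.length_ancestorList]
      exact Nat.succ_le_succ (hM.depth_le' v)
    · rintro rfl
      obtain ⟨r, _, huniq⟩ := hM.existsUnique_root
      refine Fintype.card_eq_one_iff.2 ⟨r, fun y => huniq y ?_⟩
      obtain ⟨d, hd, hd'⟩ := hM.depth_le y
      obtain rfl := Nat.le_zero.1 hd
      simpa [up] using hd'
    · intro e he
      obtain ⟨a, _, rfl⟩ := List.mem_map.1 he
      exact ⟨hle a, hL.le_codeBound hp hW hM.depth_le' a, hD1 a v⟩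
  · refine records_of_map (fun a b => ?_) hρ (fun v => by simp [ρ]) (fun _ => rfl) hR
    rw [hws.1.sameEndType_iff hp]
    exact hL.eq_iff hp a b
  · cases hv : p v with
    | none =>
      refine ⟨ρ v, [], by rw [hR, ancestorList_of_root hv]; rfl, rfl, ?_⟩
      simp [nodeInfo, hv]
    | some u =>
      refine ⟨ρ v, (ancestorList p u).map ρ,
        by rw [hR, hp.ancestorList_of_parent hv]; rfl, rfl, ?_⟩
      obtain ⟨l, hl⟩ := hp.ancestorList_eq_cons u
      simp [nodeInfo, hv, hl, hρ]
  · rw [hR, List.length_map, hp.length_ancestorList]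
    exact Nat.succ_le_succ (hM.depth_le' v)
  · rintro _ ⟨y, hy, rfl⟩
    rw [hR, hR, suffix_map_record_iff hp hids hρ, suffix_map_record_iff hp hids hρ]
    exact (hM.adj v y hy).symm
  · intro e l hel hl
    rw [hE, List.suffix_map_iff] at hel
    obtain ⟨l₀, hl₀, hel⟩ := hel
    obtain ⟨a, hav, rfl⟩ := hp.suffix_ancestorList hl₀ (by rintro rfl; simp at hel)
    cases ha : p a with
    | none =>
      rw [ancestorList_of_root ha, List.map_singleton, List.cons.injEq] at hel
      exact absurd hel.2 hl
    | some u =>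
      rw [hp.ancestorList_of_parent ha, List.map_cons, List.cons.injEq] at hel
      obtain ⟨rfl, rfl⟩ := hel
      rcases hD2 a u ha v hav with h | ⟨y, hay, hvy, hy⟩
      · exact Or.inl ⟨_, ⟨u, h, rfl⟩, by rw [hR, hfst]⟩
      · refine Or.inr ⟨_, ⟨y, hvy, rfl⟩, entry y a, (ancestorList p u).map (entry y), ?_, rfl,
          by rw [hfst, hfst], hy⟩
        rw [hE, ← List.map_cons, ← hp.ancestorList_of_parent ha]
        exact (hp.ancestorList_suffix_iff.2 hay).map _

end Verification

end KernelCert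

theorem mainTheorem4 :
    ∃ g : ℕ → ℕ → ℕ, ∀ c : ℕ, ∃ C : ℕ, ∀ k t : ℕ,
      ∃ (A : KernelCert.Verifier) (dec : List Bool → List KernelCert.AncestorRecord),
      ∀ (V : Type*) [Fintype V] (G : SimpleGraph V) (ids : V → ℕ)
        (p : V → Option V) (H : Set V),
        G.Connected → Function.Injective ids →
        (∀ v, 1 ≤ ids v ∧ ids v ≤ Fintype.card V ^ c) →
        -- yes-instances, whatever the pruning sequence that leads to `H`
        (KernelCert.IsModel G p t → KernelCert.IsCoherent G p →
          ∀ ws, KernelCert.IsCompletePruning G p k ws → H = KernelCert.remaining p ws →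
          ∃ cert : V → List Bool,
            (∀ v, ((cert v).length : ℝ) ≤ C * (t * Real.log (Fintype.card V) + g k t)) ∧
            KernelCert.Records dec G ids p ws cert ∧
            ∀ v, KernelCert.Accepts A G ids p H cert v) ∧
        -- no-instances
        (¬ (KernelCert.IsModel G p t ∧ KernelCert.IsCoherent G p ∧
            KernelCert.IsReduction G p k H) →
          ∀ cert : V → List Bool, ∃ v, ¬ KernelCert.Accepts A G ids p H cert v) ∧
        -- the data recorded in accepted certificates is correct
        (∀ cert : V → List Bool, (∀ v, KernelCert.Accepts A G ids p H cert v) →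
          ∃ ws, KernelCert.IsCompletePruning G p k ws ∧ H = KernelCert.remaining p ws ∧
            KernelCert.Records dec G ids p ws cert) := by
  refine ⟨fun k t => (t + 1) * (2 * KernelCert.codeBound k t + 8), fun c =>
    ⟨8 * (c + 1), fun k t => ⟨fun I N => KernelCert.TreeCheck t I N ∧ KernelCert.PruningCheck k I N,
      KernelCert.decodeRecords, fun V _ G ids p H hG hids hle => ⟨?_, ?_, ?_⟩⟩⟩⟩
  · exact fun hM hc ws hws hH =>
      KernelCert.exists_cert_of_isCompletePruning hids (fun v => (hle v).2) hM hc hws hH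
  · intro hno cert
    by_contra! hacc
    obtain ⟨hM, hc, ws, hws, hH, _⟩ := KernelCert.exists_records_of_checks hG hids
      (fun v => (hacc v).1) (fun v => (hacc v).2)
    exact hno ⟨hM, hc, ws, hws, hH⟩
  · intro cert hacc
    exact (KernelCert.exists_records_of_checks hG hids
      (fun v => (hacc v).1) (fun v => (hacc v).2)).2.2
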